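/- Let $p$ be a prime and $e\ge 1$, $q=p^e$. Let $\mathcal A_q$ be the algebra over the field $\mathbb F_q$ with generators $P^r$ ($r\ge 0$) and relations $P^0=1$ and $$P^aP^b=\sum_{j=0}^{\lfloor a/q\rfloor}(-1)^{a+j}\binom{(q-1)(b-j)-1}{a-qj}P^{a+b-j}P^j\qquad(a<qb),$$ augmented by $P^r\mapsto 0$ for $r>0$. For $n\ge 1$ let $\mathcal A_q(n-2)$ be the subalgebra of $\mathcal A_q$ generated by the elements $P^{p^i}$ with $0\le i<(n-1)e$, filtered by the powers of its augmentation ideal $I$ (where $I^0$ is the whole algebra), and let $E^0(\mathcal A_q(n-2))=\bigoplus_{k\ge 0}I^k/I^{k+1}$ be the associated graded algebra. For a graded vector space $V=\bigoplus_{k\ge0} V_k$ with every $V_k$ finite-dimensional, write $\Pi(V,\tau)=\sum_{k\ge 0}(\dim V_k)\,\tau^k$ for its Poincaré series. For every $n\ge 1$, the homogeneous components of $E^0(\mathcal A_q(n-2))$ are finite-dimensional over $\mathbb F_q$, and the following hold. (1) For $q=p$, $$\Pi(E^0(\mathcal A_p(n-2)),\tau)=\prod_{k=1}^{n-1}\left(\frac{1-\tau^{kp}}{1-\tau^k}\right)^{n-k}.$$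 (2) For $q=p^e$, $e\ge 1$, $\;\Pi(E^0(\mathcal A_q(n-2)),\tau)=\Pi(E^0(\mathcal A_p(n-2)),\tau)^e$. Moreover, the filtration of $\mathcal A_q(n-2)$ by the powers of $I$ coincides with the filtration induced from $\mathcal A_q$, that is, $I^k=\mathcal A_q(n-2)\cap(\mathcal A_q^+)^k$ for all $k\ge 0$, where $\mathcal A_q^+$ is the augmentation ideal of $\mathcal A_q$; so the series are the same for either filtration. -/

import Mathlib

noncomputable section

namespace SteenrodQ

/-- The defining relations of the algebra of Steenrod `q`th powers, imposed on the free `K`-algebra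
on symbols `P^r` (`r ≥ 0`): `P^0 = 1`, and the Adem relations for `a < q * b`.  In the Adem relation
`j ≤ a / q < b`, so that none of the natural-number subtractions truncates. -/
inductive AdemRel (K : Type*) [Field K] (q : ℕ) : FreeAlgebra K ℕ → FreeAlgebra K ℕ → Prop
  | zero : AdemRel K q (FreeAlgebra.ι K 0) 1
  | adem (a b : ℕ) (h : a < q * b) :
      AdemRel K q (FreeAlgebra.ι K a * FreeAlgebra.ι K b)
        (∑ j ∈ Finset.range (a / q + 1),
          ((-1 : K) ^ (a + j) * (Nat.choose ((q - 1) * (b - j) - 1) (a - q * j) : K)) •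
            (FreeAlgebra.ι K (a + b - j) * FreeAlgebra.ι K j))

/-- The algebra `A_q` of Steenrod `q`th powers with coefficients in `K` (the field with `q`
elements in the applications). -/
def SteenrodAlg (K : Type*) [Field K] (q : ℕ) : Type _ := RingQuot (AdemRel K q)

variable (K : Type*) [Field K] (q : ℕ)

instance : Ring (SteenrodAlg K q) := inferInstanceAs (Ring (RingQuot (AdemRel K q)))

instance : Algebra K (SteenrodAlg K q) := inferInstanceAs (Algebra K (RingQuot (AdemRel K q)))

/-- The quotient map from the free algebra. -/
def mk : FreeAlgebra K ℕ →ₐ[K] SteenrodAlg K q := RingQuot.mkAlgHom K (AdemRel K q)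

/-- The Steenrod power `P^r` in `A_q`. -/
def P (r : ℕ) : SteenrodAlg K q := mk K q (FreeAlgebra.ι K r)

/-- The augmentation on the free algebra: `P^0 ↦ 1` and `P^r ↦ 0` for `r > 0`. -/
def freeAug : FreeAlgebra K ℕ →ₐ[K] K := FreeAlgebra.lift K fun r => if r = 0 then 1 else 0

theorem freeAug_rel {x y : FreeAlgebra K ℕ} (h : AdemRel K q x y) :
    freeAug K x = freeAug K y := by
  induction h with
  | zero => simp [freeAug]
  | adem a b h =>
    have hb : b ≠ 0 := by rintro rfl; simp at h
    simp only [freeAug, map_mul, map_sum, map_smul, FreeAlgebra.lift_ι_apply, if_neg hb, mul_zero]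
    symm
    refine Finset.sum_eq_zero fun j hj => ?_
    have hj' : j ≤ a / q := Nat.lt_succ_iff.mp (Finset.mem_range.mp hj)
    have h2 : a / q < b := Nat.div_lt_of_lt_mul h
    have h3 : a + b - j ≠ 0 := by omega
    simp [h3]

/-- The augmentation `A_q → K`, with `P^0 ↦ 1` and `P^r ↦ 0` for `r > 0`.  Its kernel is the
augmentation ideal of `A_q`. -/
def aug : SteenrodAlg K q →ₐ[K] K :=
  RingQuot.liftAlgHom K ⟨freeAug K, fun _ _ h => freeAug_rel K q h⟩

theorem aug_P (r : ℕ) : aug K q (P K q r) = if r = 0 then 1 else 0 := by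
  refine (RingQuot.liftAlgHom_mkAlgHom_apply K (freeAug K)
    (fun _ _ h => freeAug_rel K q h) (FreeAlgebra.ι K r)).trans ?_
  simp [freeAug]

/-- For `q = p ^ e`, the subalgebra `A_q(n-2)` of `A_q` generated by the elements `P^(p^i)` with
`0 ≤ i < (n-1) * e`. -/
def sub (p e n : ℕ) : Subalgebra K (SteenrodAlg K (p ^ e)) :=
  Algebra.adjoin K {x | ∃ i < (n - 1) * e, x = P K (p ^ e) (p ^ i)}

/-- The filtration of an augmented algebra `ε : A → K` by the powers of its augmentation ideal
`ker ε`; the zeroth power is the whole algebra. -/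
def augFiltration {A : Type*} [Ring A] [Algebra K A] (ε : A →ₐ[K] K) (k : ℕ) : Submodule K A :=
  ((RingHom.ker ε : Ideal A) ^ k).restrictScalars K

/-- The May filtration of `A_q(n-2)`: the filtration by the powers of its augmentation ideal. -/
def mayFiltration (p e n : ℕ) : ℕ → Submodule K (sub K p e n) :=
  augFiltration K ((aug K (p ^ e)).comp (sub K p e n).val)

/-- The filtration of `A_q(n-2)` induced by the May filtration of `A_q`, that is, by the powers
of the augmentation ideal of `A_q`. -/
def inducedFiltration (p e n : ℕ) (k : ℕ) : Submodule K (sub K p e n) :=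
  (augFiltration K (aug K (p ^ e)) k).comap (sub K p e n).val.toLinearMap

/-- The `k`th homogeneous component `F k / F (k + 1)` of the graded object associated to a
decreasing filtration `F`. -/
abbrev gr {V : Type*} [AddCommGroup V] [Module K V] (F : ℕ → Submodule K V) (k : ℕ) : Type _ :=
  F k ⧸ (F (k + 1)).submoduleOf (F k)

/-- The `k`th homogeneous component of the graded algebra `E^0(A_q(n-2))`. -/
abbrev E0 (p e n k : ℕ) : Type _ := gr K (mayFiltration K p e n) k

/-- The Poincaré series `∑ k, dim (V k) * X ^ k` of a graded vector space with components `V k`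
(meaningful when every component is finite-dimensional). -/
def poincareSeries (V : ℕ → Type*) [∀ k, AddCommGroup (V k)] [∀ k, Module K (V k)] :
    PowerSeries ℚ :=
  PowerSeries.mk fun k => (Module.finrank K (V k) : ℚ)

end SteenrodQ

end

noncomputable section

namespace SteenrodQ

/-! The algebra acts on the polynomial ring in ξ_1, ξ_2, … (`rep`): `P^r` takes the coefficient of
X^r in the substitution ξ_t ↦ ξ_t + ξ_{t-1}^q X, where ξ_0 = 1. The Adem relations hold there by a
binomial identity (`adem_choose`). Following the action by the counit gives a pairing of A_q with
polynomials, which is faithful because admissible words span A_q and pair triangularly with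
monomials (`eq_zero_of_counit_rep`).

Give ξ_t^(p^s) weight t, so that the weight of a monomial is a weighted sum of the base-p digits of
its exponents. Each `P^r` with r > 0 lowers the weight (`rep_mem_dualFiltration`), so the k-th power
of the augmentation ideal of A_q pairs to zero with monomials of weight below k. Put N = n - 1. The
subalgebra preserves the ideal generated by the ξ_{t+1}^(p^(e(N-t))), so it is detected by the
finitely many monomials outside this ideal (`pairing_injective`).

The converse rests on `mem_truncFiltration_of_op`: modulo that ideal, a polynomial of positive
weight drops by exactly one under some `P^(p^i)` with i < eN. To leading order `P^(p^i)` is the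
derivation ξ_t^(p^i) ↦ ξ_{t-1}^(q p^i). Commutators give all ξ_t^(p^i) ↦ ξ_{t-d}^(q^d p^i), and
these are triangular in the partial derivatives with respect to the symbols ξ_t^(p^i), which detect
every nonconstant polynomial truncated at height p.

By duality (`exists_pairing_eq`), I^k is the whole annihilator of the reduced monomials of weight
below k. The induced filtration lies between the two, so all three agree, and I^k/I^(k+1) is dual to
the reduced monomials of weight k. Each of the e(n-k) symbols of weight k contributes a factor 1 +
τ^k + … + τ^((p-1)k). -/

theorem choose_mul_self_cast_eq_zero {K : Type*} [Field K] (p : ℕ) [CharP K p] {q : ℕ} (hq : p ∣ q)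
    {a : ℕ} (ha : 0 < a) : (Nat.choose (q * a) a : K) = 0 := by
  rw [CharP.cast_eq_zero_iff K p]
  obtain ⟨a, rfl⟩ := Nat.exists_eq_succ_of_ne_zero ha.ne'
  rcases Nat.eq_zero_or_pos q with rfl | hq0
  · simp
  obtain ⟨m, hm⟩ := Nat.exists_eq_succ_of_ne_zero (Nat.mul_pos hq0 ha).ne'
  have h := Nat.add_one_mul_choose_eq m a
  have h2 : Nat.choose (q * (a + 1)) (a + 1) = q * Nat.choose m a := by
    refine Nat.eq_of_mul_eq_mul_right ha ?_
    have hm' : q * (a + 1) = m + 1 := hm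
    rw [Nat.succ_eq_add_one, hm', ← h, ← hm']
    ring
  exact h2 ▸ hq.mul_right _

/-! ### Binomial identities in characteristic p behind the Adem relations. -/

section

variable {K : Type*} [Field K] (p e : ℕ) [Fact p.Prime] [CharP K p]

open PowerSeries

theorem one_sub_X_pow_char_pow :
    (1 - X : PowerSeries K) ^ (p ^ e) = 1 - X ^ (p ^ e) := by
  have : CharP (PowerSeries K) p :=
    charP_of_injective_ringHom (PowerSeries.C_injective (R := K)) p
  rw [sub_pow_char_pow, one_pow]

theorem coeff_geom_pow (a d : ℕ) :
    coeff a ((PowerSeries.mk 1 : PowerSeries K) ^ (d + 1)) = (Nat.choose (d + a) d : K) := by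
  rw [mk_one_pow_eq_mk_choose_add, coeff_mk]

/-- The generating-function form of the Adem binomial identity. -/
theorem coeff_geom_pow_mul (he : 1 ≤ e) (n a : ℕ) :
    coeff a ((PowerSeries.mk 1 : PowerSeries K) ^ ((p ^ e - 1) * a + n + 1) * (1 - X ^ (p ^ e + 1)) ^ n) =
      (Nat.choose n a : K) := by
  have hp : 1 ≤ p ^ e := Nat.one_le_pow _ _ (Fact.out : p.Prime).pos
  induction n generalizing a with
  | zero =>
    rw [pow_zero, mul_one, add_zero, coeff_geom_pow]
    rcases Nat.eq_zero_or_pos a with rfl | ha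
    · simp
    · rw [Nat.choose_eq_zero_of_lt ha, Nat.choose_symm_add,
        show (p ^ e - 1) * a + a = p ^ e * a by
          rw [← Nat.succ_mul, Nat.succ_eq_add_one, Nat.sub_add_cancel hp]]
      simpa using choose_mul_self_cast_eq_zero p (dvd_pow_self p (by omega)) ha
  | succ n ih =>
    have hG : (PowerSeries.mk 1 : PowerSeries K) * (1 - X) = 1 := mk_one_mul_one_sub_eq_one K
    have hGq : (PowerSeries.mk 1 : PowerSeries K) ^ (p ^ e) * (1 - X ^ (p ^ e)) = 1 := by
      rw [← one_sub_X_pow_char_pow, ← mul_pow, hG, one_pow]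
    cases a with
    | zero =>
      simp [coeff_zero_eq_constantCoeff]
    | succ a =>
      rw [Nat.choose_succ_succ, Nat.cast_add, ← ih a, ← ih (a + 1), ← coeff_succ_mul_X a, ← map_add]
      congr 1
      -- With G = 1/(1 - X) and G^q (1 - X^q) = 1, Pascal's rule becomes the identity G^q (1 -
      -- X^(q+1)) = X + G^(q-1).
      generalize (PowerSeries.mk 1 : PowerSeries K) = G at *
      obtain ⟨r, hr⟩ := Nat.exists_eq_add_of_le' hp
      rw [hr] at hGq ⊢
      simp only [Nat.add_sub_cancel]
      have e1 : G ^ (r * (a + 1) + (n + 1) + 1) = G ^ (r * a + n + 1) * G ^ (r + 1) := by ring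
      have e2 : G ^ (r * (a + 1) + n + 1) = G ^ (r * a + n + 1) * G ^ r := by ring
      rw [e1, e2]
      have e3 : G ^ r = G ^ (r + 1) * (1 - X) := by
        rw [pow_succ, mul_assoc, hG, mul_one]
      rw [e3]
      have e4 : G ^ (r * a + n + 1) * (1 - X ^ (r + 1 + 1)) ^ n * X =
        G ^ (r * a + n + 1) * (1 - X ^ (r + 1 + 1)) ^ n * X * (G ^ (r + 1) * (1 - X ^ (r + 1))) := by
        rw [hGq, mul_one]
      rw [e4]
      ring

theorem coeff_one_sub_X_pow (m k : ℕ) :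
    coeff k ((1 - X : PowerSeries K) ^ m) = (-1) ^ k * (Nat.choose m k : K) := by
  have h : (1 - X : PowerSeries K) ^ m =
      (((1 - Polynomial.X : Polynomial K) ^ m : Polynomial K) : PowerSeries K) := by simp
  rw [h, Polynomial.coeff_coe, sub_eq_add_neg, add_comm, ← neg_one_mul (Polynomial.X : Polynomial K)]
  have h2 : ((-1 : Polynomial K) * Polynomial.X + 1) =
      (Polynomial.X + 1 : Polynomial K).comp (Polynomial.C (-1) * Polynomial.X) := by simp
  rw [h2, ← Polynomial.pow_comp, Polynomial.comp_C_mul_X_coeff, Polynomial.coeff_X_add_one_pow, mul_comm]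

theorem neg_one_pow_char_pow : (-1 : K) ^ (p ^ e) = -1 := by
  rw [← sub_zero (1 : K), ← neg_sub, neg_neg, sub_pow_char_pow]
  simp [(Fact.out : p.Prime).ne_zero]

/-- With G = 1/(1 - X), the sum is the coefficient of X^a in (1 - X)^((q-1)b-1) (1 + X^q
G^(q-1))^(a+b). In characteristic p the last base equals G^q (1 - X^(q+1)), and `coeff_geom_pow_mul`
evaluates the product. -/
theorem adem_choose (he : 1 ≤ e) {a b : ℕ} (h : a < p ^ e * b) :
    ∑ l ∈ Finset.range (a / p ^ e + 1), (-1 : K) ^ (a + l) *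
      (Nat.choose ((p ^ e - 1) * (b - l) - 1) (a - p ^ e * l) : K) * (Nat.choose (a + b) l : K) =
      (Nat.choose (a + b) a : K) := by
  have hp : 1 < p ^ e := Nat.one_lt_pow (by omega) (Fact.out : p.Prime).one_lt
  have hneg := neg_one_pow_char_pow (K := K) p e
  have hG : (PowerSeries.mk 1 : PowerSeries K) * (1 - X) = 1 := mk_one_mul_one_sub_eq_one K
  have hGq : (PowerSeries.mk 1 : PowerSeries K) ^ (p ^ e) * (1 - X ^ (p ^ e)) = 1 := by
    rw [← one_sub_X_pow_char_pow, ← mul_pow, hG, one_pow]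
  rw [← coeff_geom_pow_mul p e he (a + b) a]
  have hdiv : a / p ^ e < b := Nat.div_lt_of_lt_mul h
  generalize hQ : p ^ e = Q at *
  obtain ⟨r, rfl⟩ := Nat.exists_eq_add_of_le' hp.le
  simp only [Nat.add_sub_cancel] at *
  have hr : 0 < r := by omega
  set G := (PowerSeries.mk 1 : PowerSeries K) with hGdef
  have hGp : ∀ m, G ^ m * (1 - X) ^ m = 1 := fun m => by rw [← mul_pow, hG, one_pow]
  have key : ∀ l ∈ Finset.range (a / (r + 1) + 1), (-1 : K) ^ (a + l) *
      (Nat.choose (r * (b - l) - 1) (a - (r + 1) * l) : K) * (Nat.choose (a + b) l : K) =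
      coeff a ((1 - X) ^ (r * b - 1) *
        ((X ^ (r + 1) * G ^ r) ^ l * 1 ^ (a + b - l) * (Nat.choose (a + b) l : PowerSeries K))) := by
    intro l hl
    have hl' : l ≤ a / (r + 1) := Nat.lt_succ_iff.mp (Finset.mem_range.mp hl)
    have hla : (r + 1) * l ≤ a := by
      rw [mul_comm]; exact (Nat.le_div_iff_mul_le (by omega)).mp hl'
    have hlb : l < b := by omega
    have e1 : (1 - X : PowerSeries K) ^ (r * b - 1) = (1 - X) ^ (r * (b - l) - 1) * (1 - X) ^ (r * l) := by
      rw [← pow_add]; congr 1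
      obtain ⟨c, rfl⟩ := Nat.exists_eq_add_of_lt hlb
      rw [show l + c + 1 - l = c + 1 by omega, show r * (l + c + 1) = r * (c + 1) + r * l by ring]
      have : 0 < r * (c + 1) := Nat.mul_pos hr (by omega)
      omega
    have e2 : (1 - X : PowerSeries K) ^ (r * b - 1) *
        ((X ^ (r + 1) * G ^ r) ^ l * 1 ^ (a + b - l) * (Nat.choose (a + b) l : PowerSeries K)) =
        ((1 - X) ^ (r * (b - l) - 1) * C (Nat.choose (a + b) l : K)) * X ^ ((r + 1) * l) := by
      rw [e1, map_natCast, one_pow, mul_one, mul_pow, ← pow_mul, ← pow_mul]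
      linear_combination ((1 - X) ^ (r * (b - l) - 1) * X ^ ((r + 1) * l) *
        (Nat.choose (a + b) l : PowerSeries K)) * hGp (r * l)
    rw [e2, coeff_mul_X_pow', if_pos hla, coeff_mul_C, coeff_one_sub_X_pow]
    congr 2
    -- Since (-1)^q = -1 in `K` (also for p = 2), the signs (-1)^(a+l) and (-1)^(a-ql) agree.
    obtain ⟨c, rfl⟩ := Nat.exists_eq_add_of_le hla
    rw [Nat.add_sub_cancel_left, pow_add, pow_add, pow_mul, hneg, mul_comm (_ ^ l), mul_assoc, ← mul_pow]
    simp
  rw [Finset.sum_congr rfl key, ← map_sum, ← Finset.mul_sum]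
  have hext : coeff a ((1 - X : PowerSeries K) ^ (r * b - 1) * ∑ l ∈ Finset.range (a / (r + 1) + 1),
      ((X ^ (r + 1) * G ^ r) ^ l * 1 ^ (a + b - l) * (Nat.choose (a + b) l : PowerSeries K))) =
      coeff a ((1 - X : PowerSeries K) ^ (r * b - 1) * (X ^ (r + 1) * G ^ r + 1) ^ (a + b)) := by
    rw [add_pow]
    -- The terms with ql > a do not reach degree a, so the sum may be completed to the full binomial
    -- expansion.
    have hsub : Finset.range (a / (r + 1) + 1) ⊆ Finset.range (a + b + 1) :=
      Finset.range_mono (by omega)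
    rw [← Finset.sum_sdiff hsub, mul_add, map_add, right_eq_add, Finset.mul_sum, map_sum]
    refine Finset.sum_eq_zero fun l hl => ?_
    have hl' : a / (r + 1) < l := by
      simp only [Finset.mem_sdiff, Finset.mem_range] at hl; omega
    have hla : a < (r + 1) * l := by
      rw [mul_comm]; exact (Nat.div_lt_iff_lt_mul (by omega)).mp hl'
    rw [mul_pow, ← pow_mul, mul_assoc, mul_assoc, mul_left_comm, coeff_X_pow_mul', if_neg (by omega)]
  rw [hext]
  congr 1
  have e5 : X ^ (r + 1) * G ^ r + 1 = G ^ (r + 1) * (1 - X ^ (r + 1 + 1)) := by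
    have : G ^ r = G ^ (r + 1) * (1 - X) := by rw [pow_succ, mul_assoc, hG, mul_one]
    rw [this]
    linear_combination -hGq
  rw [e5, mul_pow, ← pow_mul, show (r + 1) * (a + b) = (r * a + (a + b) + 1) + (r * b - 1) by
    have h2 : 0 < r * b := Nat.mul_pos hr ((Nat.zero_le _).trans_lt hdiv)
    have h3 : (r + 1) * (a + b) = r * a + a + b + r * b := by ring
    rw [h3]
    clear h
    omega]
  rw [pow_add G]
  linear_combination (G ^ (r * a + (a + b) + 1) * (1 - X ^ (r + 1 + 1)) ^ (a + b)) * hGp (r * b - 1)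

end

/-! ### The total operation on the dual polynomial algebra, and the Adem relations for it. -/

section TotalOperation

variable (K : Type*) [Field K]

/-- The generators of the polynomial algebra dual to the Steenrod algebra, with `xi 0 = 1`. -/
def xi : ℕ → MvPolynomial ℕ K
  | 0 => 1
  | t + 1 => MvPolynomial.X t

@[simp] theorem xi_zero : xi K 0 = 1 := rfl

@[simp] theorem xi_succ (t : ℕ) : xi K (t + 1) = MvPolynomial.X t := rfl

/-- The total Steenrod operation `xi t ↦ xi t + xi (t - 1) ^ q * X`. -/
def totalOp (q : ℕ) : MvPolynomial ℕ K →ₐ[K] Polynomial (MvPolynomial ℕ K) :=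
  MvPolynomial.aeval fun t =>
    Polynomial.C (MvPolynomial.X t) + Polynomial.C (xi K t ^ q) * Polynomial.X

/-- The action of `P^r` on the dual algebra: a coefficient of the total operation. -/
def op (q r : ℕ) : MvPolynomial ℕ K →ₗ[K] MvPolynomial ℕ K :=
  ((Polynomial.lcoeff (MvPolynomial ℕ K) r).restrictScalars K) ∘ₗ (totalOp K q).toLinearMap

variable {K}

theorem op_apply (q r : ℕ) (f : MvPolynomial ℕ K) : op K q r f = (totalOp K q f).coeff r := rfl

@[simp] theorem totalOp_X (q t : ℕ) : totalOp K q (MvPolynomial.X t) =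
    Polynomial.C (MvPolynomial.X t) + Polynomial.C (xi K t ^ q) * Polynomial.X := by
  simp [totalOp]

theorem op_zero (q : ℕ) : op K q 0 = LinearMap.id := by
  have h : ((Polynomial.aeval (0 : MvPolynomial ℕ K)).restrictScalars K).comp (totalOp K q) =
      AlgHom.id K _ := by
    ext t
    simp
  refine LinearMap.ext fun f => ?_
  have := congrArg (fun g => g f) h
  simpa [op_apply, Polynomial.coeff_zero_eq_eval_zero] using this

/-- The composite of two total operations, with parameters the inner and the outer variable. -/
def totalOpTwo (q : ℕ) : MvPolynomial ℕ K →ₐ[K] Polynomial (Polynomial (MvPolynomial ℕ K)) :=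
  (Polynomial.mapAlgHom (totalOp K q)).comp (totalOp K q)

theorem coeff_totalOpTwo (q a b : ℕ) (f : MvPolynomial ℕ K) :
    ((totalOpTwo q f).coeff b).coeff a = op K q a (op K q b f) := by
  simp [totalOpTwo, op_apply]

theorem coeff_coeff_pow_mul_pow {S : Type*} [CommRing S] (q i j a b : ℕ) :
    ((((Polynomial.X + Polynomial.C Polynomial.X) ^ i *
      (Polynomial.C (Polynomial.X ^ q) * Polynomial.X) ^ j : Polynomial (Polynomial S))).coeff b).coeff a =
      if j ≤ b ∧ a + b = i + (q + 1) * j then (Nat.choose i (b - j) : S) else 0 := by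
  rw [mul_pow, ← map_pow, ← pow_mul, ← mul_assoc, Polynomial.coeff_mul_X_pow']
  by_cases hj : j ≤ b
  · rw [if_pos hj, Polynomial.coeff_mul_C, Polynomial.coeff_X_add_C_pow, mul_right_comm, ← pow_add,
      mul_comm, ← Polynomial.C_eq_natCast, Polynomial.coeff_C_mul_X_pow]
    by_cases hi : b - j ≤ i
    · congr 1
      rw [eq_iff_iff]
      have : (q + 1) * j = q * j + j := by ring
      constructor
      · rintro rfl; exact ⟨hj, by omega⟩
      · rintro ⟨_, h⟩; omega
    · rw [Nat.choose_eq_zero_of_lt (by omega)]; simp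
  · rw [if_neg hj, if_neg (by tauto)]; simp

variable (p e : ℕ) [Fact p.Prime] [CharP K p]

/-- With Y the inner and X the outer variable, additivity of the q-th power gives ξ_t ↦ ξ_t +
ξ_{t-1}^q (Y + X) + ξ_{t-2}^(q^2) X^q Y. The Adem relations thus need checking only on monomials in
Y + X and X^q Y. -/
theorem totalOpTwo_mem (f : MvPolynomial ℕ K) :
    totalOpTwo (p ^ e) f ∈ Algebra.adjoin (MvPolynomial ℕ K)
      {Polynomial.X + Polynomial.C Polynomial.X,
        Polynomial.C (Polynomial.X ^ (p ^ e)) * Polynomial.X} := by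
  set S := Algebra.adjoin (MvPolynomial ℕ K)
    ({Polynomial.X + Polynomial.C Polynomial.X,
        Polynomial.C (Polynomial.X ^ (p ^ e)) * Polynomial.X} :
      Set (Polynomial (Polynomial (MvPolynomial ℕ K)))) with hS
  have hu : Polynomial.X + Polynomial.C Polynomial.X ∈ S := Algebra.subset_adjoin (by simp)
  have hv : Polynomial.C (Polynomial.X ^ (p ^ e)) * Polynomial.X ∈ S :=
    Algebra.subset_adjoin (by simp)
  have hc : ∀ c : MvPolynomial ℕ K, Polynomial.C (Polynomial.C c) ∈ S := fun c =>
    S.algebraMap_mem c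
  induction f using MvPolynomial.induction_on with
  | C c =>
    have : totalOpTwo (p ^ e) (MvPolynomial.C c) = Polynomial.C (Polynomial.C (MvPolynomial.C c)) := by
      simp [totalOpTwo]
    rw [this]; exact hc _
  | add f g hf hg => rw [map_add]; exact S.add_mem hf hg
  | mul_X f t hf =>
    rw [map_mul]
    refine S.mul_mem hf ?_
    have h1 : totalOpTwo (K := K) (p ^ e) (MvPolynomial.X t) =
        Polynomial.C (Polynomial.C (MvPolynomial.X t)) +
          Polynomial.C (Polynomial.C (xi K t ^ (p ^ e)) * Polynomial.X) +
          Polynomial.C (totalOp K (p ^ e) (xi K t) ^ (p ^ e)) * Polynomial.X := by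
      simp [totalOpTwo]
    rw [h1]
    cases t with
    | zero =>
      have : Polynomial.C (Polynomial.C (MvPolynomial.X 0)) +
          Polynomial.C (Polynomial.C (xi K 0 ^ (p ^ e)) * Polynomial.X) +
          Polynomial.C (totalOp K (p ^ e) (xi K 0) ^ (p ^ e)) * Polynomial.X =
          Polynomial.C (Polynomial.C (MvPolynomial.X 0)) +
            (Polynomial.X + Polynomial.C Polynomial.X) := by
        simp only [xi_zero, one_pow, map_one, one_mul]
        ring
      rw [this]
      exact S.add_mem (hc _) hu
    | succ t =>
      have h2 : totalOp K (p ^ e) (xi K (t + 1)) ^ (p ^ e) =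
          Polynomial.C (xi K (t + 1) ^ (p ^ e)) +
            Polynomial.C ((xi K t ^ (p ^ e)) ^ (p ^ e)) * Polynomial.X ^ (p ^ e) := by
        rw [xi_succ, totalOp_X, add_pow_char_pow, mul_pow, ← map_pow, ← map_pow]
      rw [h2]
      have : Polynomial.C (Polynomial.C (MvPolynomial.X (t + 1))) +
          Polynomial.C (Polynomial.C (xi K (t + 1) ^ (p ^ e)) * Polynomial.X) +
          Polynomial.C (Polynomial.C (xi K (t + 1) ^ (p ^ e)) +
            Polynomial.C ((xi K t ^ (p ^ e)) ^ (p ^ e)) * Polynomial.X ^ (p ^ e)) * Polynomial.X =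
          Polynomial.C (Polynomial.C (MvPolynomial.X (t + 1))) +
          Polynomial.C (Polynomial.C (xi K (t + 1) ^ (p ^ e))) *
            (Polynomial.X + Polynomial.C Polynomial.X) +
          Polynomial.C (Polynomial.C ((xi K t ^ (p ^ e)) ^ (p ^ e))) *
            (Polynomial.C (Polynomial.X ^ (p ^ e)) * Polynomial.X) := by
        simp only [map_add, map_mul]
        ring
      rw [this]
      exact S.add_mem (S.add_mem (hc _) (S.mul_mem (hc _) hu)) (S.mul_mem (hc _) hv)

/-- The coefficient of `P^(a+b-j) P^j` in the Adem relation for `P^a P^b`. -/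
def ademCoeff (K : Type*) [Field K] (q a b j : ℕ) : K :=
  (-1 : K) ^ (a + j) * (Nat.choose ((q - 1) * (b - j) - 1) (a - q * j) : K)

/-- Stripping the j-th power of X^q Y replaces a, b, l by a - qj, b - j, l - j, which leaves the
Adem coefficients unchanged, so `adem_choose` applies. If qj > a, both sides vanish. -/
theorem adem_coeff_coeff (he : 1 ≤ e) {a b : ℕ} (h : a < p ^ e * b) (i j : ℕ) :
    (if j ≤ b ∧ a + b = i + (p ^ e + 1) * j then (Nat.choose i (b - j) : K) else 0) =
      ∑ l ∈ Finset.range (a / p ^ e + 1), ademCoeff K (p ^ e) a b l *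
        (if j ≤ l ∧ (a + b - l) + l = i + (p ^ e + 1) * j then (Nat.choose i (l - j) : K) else 0) := by
  have hp : 0 < p ^ e := pow_pos (Fact.out : p.Prime).pos _
  have hneg := neg_one_pow_char_pow (K := K) p e
  have hdiv : a / p ^ e < b := Nat.div_lt_of_lt_mul h
  have hl : ∀ l ∈ Finset.range (a / p ^ e + 1), (a + b - l) + l = a + b := fun l hl => by
    have : l < a / p ^ e + 1 := Finset.mem_range.mp hl
    omega
  rw [Finset.sum_congr rfl fun l hl' => by rw [hl l hl']]
  by_cases hd : a + b = i + (p ^ e + 1) * j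
  swap
  · simp [hd]
  simp only [hd, and_true]
  have hd' : a + b = i + p ^ e * j + j := by rw [hd]; ring
  by_cases hja : p ^ e * j ≤ a
  · obtain ⟨a', rfl⟩ := Nat.exists_eq_add_of_le hja
    have hjb : j ≤ b := by
      by_contra hb
      have : p ^ e * b ≤ p ^ e * j := Nat.mul_le_mul_left _ (by omega)
      omega
    obtain ⟨b', rfl⟩ := Nat.exists_eq_add_of_le hjb
    have hi : i = a' + b' := by omega
    subst hi
    have h' : a' < p ^ e * b' := by
      rw [mul_add] at h; omega
    rw [if_pos hjb, Nat.add_sub_cancel_left, ← Nat.choose_symm_add, ← adem_choose p e he h',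
      Nat.mul_add_div hp, add_assoc j, Finset.sum_range_add _ j]
    rw [Finset.sum_eq_zero (s := Finset.range j), zero_add]
    · refine Finset.sum_congr rfl fun l _ => ?_
      rw [if_pos (Nat.le_add_right _ _), Nat.add_sub_cancel_left, ademCoeff, Nat.add_sub_add_left,
        mul_add, Nat.add_sub_add_left]
      congr 2
      rw [show p ^ e * j + a' + (j + l) = p ^ e * j + j + (a' + l) by ring, pow_add _ (p ^ e * j + j), pow_add _ (p ^ e * j),
        pow_mul, hneg, ← mul_pow]
      simp
    · intro l hl
      have : l < j := Finset.mem_range.mp hl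
      rw [if_neg (by omega), mul_zero]
  · have hlt : a / p ^ e < j := by
      rw [Nat.div_lt_iff_lt_mul hp, mul_comm]; omega
    rw [Finset.sum_eq_zero]
    · split_ifs with hjb
      · rw [Nat.choose_eq_zero_of_lt (by omega), Nat.cast_zero]
      · rfl
    · intro l hl
      have : l < a / p ^ e + 1 := Finset.mem_range.mp hl
      rw [if_neg (by omega), mul_zero]

theorem op_adem (he : 1 ≤ e) {a b : ℕ} (h : a < p ^ e * b) (f : MvPolynomial ℕ K) :
    op K (p ^ e) a (op K (p ^ e) b f) =
      ∑ l ∈ Finset.range (a / p ^ e + 1), ademCoeff K (p ^ e) a b l •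
        op K (p ^ e) (a + b - l) (op K (p ^ e) l f) := by
  simp only [← coeff_totalOpTwo]
  have hmem := totalOpTwo_mem (K := K) p e f
  generalize totalOpTwo (p ^ e) f = F at hmem
  rw [← Subalgebra.mem_toSubmodule, Algebra.adjoin_eq_span] at hmem
  induction hmem using Submodule.span_induction with
  | mem F hF =>
    obtain ⟨i, j, rfl⟩ := (Submonoid.mem_closure_pair (Polynomial.X + Polynomial.C Polynomial.X)
      (Polynomial.C (Polynomial.X ^ (p ^ e)) * Polynomial.X) F).mp hF
    simp only [coeff_coeff_pow_mul_pow]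
    have := congrArg (algebraMap K (MvPolynomial ℕ K)) (adem_coeff_coeff (K := K) p e he h i j)
    simpa [Algebra.smul_def, apply_ite (MvPolynomial.C (σ := ℕ) (R := K))] using this
  | zero => simp
  | add F G _ _ hF hG => simp [hF, hG, Finset.sum_add_distrib]
  | smul c F _ hF =>
    simp only [Polynomial.coeff_smul, hF, Finset.smul_sum]
    exact Finset.sum_congr rfl fun l _ => smul_comm _ _ _

/-- The action of the Steenrod algebra on the dual polynomial algebra. -/
def rep (he : 1 ≤ e) : SteenrodAlg K (p ^ e) →ₐ[K] Module.End K (MvPolynomial ℕ K) :=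
  RingQuot.liftAlgHom K ⟨FreeAlgebra.lift K (op K (p ^ e)), fun x y h => by
    induction h with
    | zero => rw [FreeAlgebra.lift_ι_apply, op_zero, map_one]; rfl
    | adem a b h =>
      simp only [map_mul, map_sum, map_smul, FreeAlgebra.lift_ι_apply]
      refine LinearMap.ext fun f => ?_
      simpa [LinearMap.sum_apply, ademCoeff] using op_adem p e he h f⟩

theorem rep_P (he : 1 ≤ e) (r : ℕ) : rep (K := K) p e he (P K (p ^ e) r) = op K (p ^ e) r := by
  refine (RingQuot.liftAlgHom_mkAlgHom_apply K (FreeAlgebra.lift K (op K (p ^ e)))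
    _ (FreeAlgebra.ι K r)).trans ?_
  simp

end TotalOperation

/-! ### Admissible words span the algebra. -/

section Admissible

variable (K : Type*) [Field K] (q : ℕ)

theorem P_zero : P K q 0 = 1 := by
  have := RingQuot.mkAlgHom_rel K (AdemRel.zero (K := K) (q := q))
  rw [map_one] at this
  exact this

theorem P_mul_P {a b : ℕ} (h : a < q * b) : P K q a * P K q b =
    ∑ j ∈ Finset.range (a / q + 1), ademCoeff K q a b j • (P K q (a + b - j) * P K q j) := by
  have := RingQuot.mkAlgHom_rel K (AdemRel.adem (K := K) (q := q) a b h)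
  simp only [map_mul, map_sum, map_smul] at this
  exact this

/-- The span of the admissible words `P^(i_1) ⋯ P^(i_k)` of length `k` with `j ≤ i_k`. -/
def adm : ℕ → ℕ → Submodule K (SteenrodAlg K q)
  | 0, _ => 1
  | k + 1, j => ⨆ i, (adm k (q * (j + i))).map (LinearMap.mulRight K (P K q (j + i)))

variable {K q}

theorem mul_P_mem_adm {k i j : ℕ} (h : j ≤ i) {y : SteenrodAlg K q} (hy : y ∈ adm K q k (q * i)) :
    y * P K q i ∈ adm K q (k + 1) j := by
  obtain ⟨d, rfl⟩ := Nat.exists_eq_add_of_le h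
  rw [adm]
  exact Submodule.mem_iSup_of_mem d ⟨y, hy, rfl⟩

theorem adm_succ_le {k j : ℕ} {S : Submodule K (SteenrodAlg K q)}
    (h : ∀ i, j ≤ i → ∀ y ∈ adm K q k (q * i), y * P K q i ∈ S) : adm K q (k + 1) j ≤ S := by
  rw [adm]
  refine iSup_le fun i => ?_
  rintro _ ⟨y, hy, rfl⟩
  exact h _ (Nat.le_add_right _ _) y hy

theorem adm_anti (k : ℕ) {i j : ℕ} (h : i ≤ j) : adm K q k j ≤ adm K q k i := by
  cases k with
  | zero => exact le_rfl
  | succ k => exact adm_succ_le fun m hm y hy => mul_P_mem_adm (h.trans hm) hy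

/-- Double induction: an Adem relation turns y P^a P^b into terms y P^(a+b-j) P^j with j < b.
Induction on length makes y P^(a+b-j) admissible, and induction on b handles the last factor. -/
theorem mul_P_mem_adm_zero (k b : ℕ) {x : SteenrodAlg K q} (hx : x ∈ adm K q k 0) :
    x * P K q b ∈ adm K q (k + 1) 0 := by
  induction k generalizing b x with
  | zero => exact mul_P_mem_adm (Nat.zero_le b) (by simpa only [adm] using hx)
  | succ k ihk =>
    induction b using Nat.strong_induction_on generalizing x with
    | _ b ihb =>
      refine (adm_succ_le (S := (adm K q (k + 1 + 1) 0).comap (LinearMap.mulRight K (P K q b)))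
        fun a _ y hy => ?_) hx
      rw [Submodule.mem_comap, LinearMap.mulRight_apply]
      by_cases hab : a < q * b
      · rw [mul_assoc, P_mul_P K q hab, Finset.mul_sum]
        refine Submodule.sum_mem _ fun j hj => ?_
        have hj' : j < b := (Nat.lt_succ_iff.mp (Finset.mem_range.mp hj)).trans_lt
          (Nat.div_lt_of_lt_mul hab)
        rw [mul_smul_comm, ← mul_assoc]
        exact Submodule.smul_mem _ _ (ihb j hj' (ihk _ (adm_anti k (Nat.zero_le _) hy)))
      · exact mul_P_mem_adm (Nat.zero_le b) (mul_P_mem_adm (not_lt.mp hab) hy)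

theorem adm_zero_mono : Monotone fun k => adm K q k 0 :=
  monotone_nat_of_le_succ fun k x hx => by
    simpa [P_zero] using mul_P_mem_adm_zero k 0 hx

theorem mk_surjective : Function.Surjective (mk K q) := RingQuot.mkAlgHom_surjective K _

theorem exists_mem_adm (x : SteenrodAlg K q) : ∃ k, x ∈ adm K q k 0 := by
  obtain ⟨f, rfl⟩ := mk_surjective x
  suffices h : ∀ (k : ℕ), ∀ y ∈ adm K q k 0, ∃ l, y * mk K q f ∈ adm K q l 0 by
    simpa using h 0 1 (Submodule.one_le.mp le_rfl)
  induction f using FreeAlgebra.induction with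
  | grade0 r =>
    intro k y hy
    refine ⟨k, ?_⟩
    rw [AlgHom.commutes, ← Algebra.commutes, ← Algebra.smul_def]
    exact Submodule.smul_mem _ _ hy
  | grade1 i => exact fun k y hy => ⟨k + 1, mul_P_mem_adm_zero k i hy⟩
  | mul f g hf hg =>
    intro k y hy
    obtain ⟨l, hl⟩ := hf k y hy
    obtain ⟨m, hm⟩ := hg l _ hl
    exact ⟨m, by rwa [map_mul, ← mul_assoc]⟩
  | add f g hf hg =>
    intro k y hy
    obtain ⟨l, hl⟩ := hf k y hy
    obtain ⟨m, hm⟩ := hg k y hy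
    refine ⟨max l m, ?_⟩
    rw [map_add, mul_add]
    exact Submodule.add_mem _ (adm_zero_mono (le_max_left l m) hl) (adm_zero_mono (le_max_right l m) hm)

end Admissible

/-! ### Faithfulness of the pairing, by triangularity on admissible words. -/

section Faithful

variable (K : Type*) [Field K]

/-- The counit of the dual algebra. -/
def counit : MvPolynomial ℕ K →ₐ[K] K := MvPolynomial.aeval fun _ => 0

/-- The ideal generated by the `xi t` with `t > k`. -/
def tailIdeal (k : ℕ) : Ideal (MvPolynomial ℕ K) := Ideal.span {f | ∃ t, k ≤ t ∧ f = MvPolynomial.X t}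

variable {K}

theorem X_mem_tailIdeal {k t : ℕ} (h : k ≤ t) : MvPolynomial.X t ∈ tailIdeal K k :=
  Ideal.subset_span ⟨t, h, rfl⟩

theorem counit_of_mem_tailIdeal {k : ℕ} {f : MvPolynomial ℕ K} (hf : f ∈ tailIdeal K k) :
    counit K f = 0 := by
  have : tailIdeal K k ≤ RingHom.ker (counit K) := by
    refine Ideal.span_le.mpr ?_
    rintro _ ⟨t, _, rfl⟩
    simp [counit, RingHom.mem_ker]
  exact this hf

theorem op_mem_tailIdeal {q : ℕ} (hq : q ≠ 0) (r : ℕ) {k : ℕ} {f : MvPolynomial ℕ K}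
    (hf : f ∈ tailIdeal K (k + 1)) : op K q r f ∈ tailIdeal K k := by
  have h : tailIdeal K (k + 1) ≤ (Ideal.map Polynomial.C (tailIdeal K k)).comap (totalOp K q) := by
    refine Ideal.span_le.mpr ?_
    rintro _ ⟨t, ht, rfl⟩
    obtain ⟨t, rfl⟩ := Nat.exists_eq_add_of_le' (Nat.one_le_of_lt ht)
    simp only [Ideal.coe_comap, Set.mem_preimage, SetLike.mem_coe, totalOp_X, xi_succ]
    refine Ideal.add_mem _ (Ideal.mem_map_of_mem _ (X_mem_tailIdeal (by omega)))
      (Ideal.mul_mem_right _ _ (Ideal.mem_map_of_mem _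
        (Ideal.pow_mem_of_mem _ (X_mem_tailIdeal (by omega)) _ (Nat.pos_of_ne_zero hq))))
  exact Ideal.mem_map_C_iff.mp (h hf) r

/-- Modulo ξ_{k+1}, the total operation sends ξ_{k+1}^m to ξ_k^(qm) X^m, so m of the r units must be
spent on this factor. -/
theorem op_mul_X_pow_sub_mem (q m r k : ℕ) (g : MvPolynomial ℕ K) :
    op K q r (g * MvPolynomial.X k ^ m) -
      (if m ≤ r then op K q (r - m) g * xi K k ^ (q * m) else 0) ∈ tailIdeal K k := by
  have h : totalOp K q (g * MvPolynomial.X k ^ m) -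
      totalOp K q g * Polynomial.C (xi K k ^ (q * m)) * Polynomial.X ^ m ∈
      Ideal.map Polynomial.C (tailIdeal K k) := by
    have h1 := sub_dvd_pow_sub_pow (Polynomial.C (MvPolynomial.X k) + Polynomial.C (xi K k ^ q) * Polynomial.X)
      (Polynomial.C (xi K k ^ q) * Polynomial.X) m
    rw [add_sub_cancel_right] at h1
    have h2 := Ideal.mem_of_dvd _ h1 (Ideal.mem_map_of_mem Polynomial.C (X_mem_tailIdeal (K := K) (le_refl k)))
    have h3 := Ideal.mul_mem_left _ (totalOp K q g) h2
    convert h3 using 1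
    rw [map_mul, map_pow, totalOp_X, mul_sub, mul_pow (Polynomial.C _) Polynomial.X, ← map_pow, ← pow_mul,
      mul_assoc]
  have h4 := Ideal.mem_map_C_iff.mp h r
  rw [Polynomial.coeff_sub, Polynomial.coeff_mul_X_pow'] at h4
  convert h4 using 2
  · rfl
  · rw [Polynomial.coeff_mul_C, op_apply]

variable (p e : ℕ) [Fact p.Prime] [CharP K p] (he : 1 ≤ e)

/-- An operation lowers the index of a ξ by at most one, so a word of length k cannot bring ξ_t with
t > k down to ξ_0 = 1. -/
theorem counit_rep_of_mem_adm {k j : ℕ} {x : SteenrodAlg K (p ^ e)} (hx : x ∈ adm K (p ^ e) k j)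
    {f : MvPolynomial ℕ K} (hf : f ∈ tailIdeal K k) : counit K (rep p e he x f) = 0 := by
  have hq : p ^ e ≠ 0 := pow_ne_zero _ (Fact.out : p.Prime).ne_zero
  induction k generalizing j x f with
  | zero =>
    obtain ⟨c, rfl⟩ := Submodule.mem_one.mp hx
    rw [AlgHom.commutes, Module.algebraMap_end_apply, map_smul, counit_of_mem_tailIdeal hf, smul_zero]
  | succ k ih =>
    let L : SteenrodAlg K (p ^ e) →ₗ[K] K :=
      (counit K).toLinearMap ∘ₗ LinearMap.applyₗ f ∘ₗ (rep p e he).toLinearMap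
    have : adm K (p ^ e) (k + 1) j ≤ LinearMap.ker L := by
      refine adm_succ_le fun i _ y hy => ?_
      change counit K (rep p e he (y * P K (p ^ e) i) f) = 0
      rw [map_mul, Module.End.mul_apply, rep_P]
      exact ih hy (op_mem_tailIdeal hq i hf)
    exact this hx

/-- Sort the words by their last entry. Against multiples of ξ_{k+1}^m, where m is the largest last
entry present, smaller last entries contribute nothing and `P^m` leaves a multiple of ξ_k^(qm). This
is the test required for the remaining words of length k, whose own last entries are at least qm;
hence the power of ξ_k in the hypothesis. -/
theorem eq_zero_of_mem_adm {k j : ℕ} {x : SteenrodAlg K (p ^ e)} (hx : x ∈ adm K (p ^ e) k j)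
    (h : ∀ g, counit K (rep p e he x (g * xi K k ^ j)) = 0) : x = 0 := by
  induction k generalizing j x with
  | zero =>
    obtain ⟨c, rfl⟩ := Submodule.mem_one.mp hx
    have := h 1
    rw [AlgHom.commutes, Module.algebraMap_end_apply] at this
    simp only [xi_zero, one_pow, mul_one, map_smul, map_one, smul_eq_mul] at this
    rw [this, map_zero]
  | succ k ih =>
    rw [adm, Submodule.mem_iSup_iff_exists_finsupp] at hx
    obtain ⟨F, hF, rfl⟩ := hx
    suffices F = 0 by simp [this]
    by_contra hne
    have hs : F.support.Nonempty := Finsupp.support_nonempty_iff.mpr hne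
    set i := F.support.max' hs with hi
    have hiF : i ∈ F.support := F.support.max'_mem hs
    obtain ⟨y, hy, hyi⟩ := hF i
    refine Finsupp.mem_support_iff.mp hiF ?_
    rw [← hyi, ih hy, map_zero]
    intro g
    have h1 := h (g * MvPolynomial.X k ^ i)
    rw [Finsupp.sum, map_sum, LinearMap.sum_apply, map_sum, Finset.sum_eq_single_of_mem i hiF, ← hyi,
      xi_succ, mul_assoc, ← pow_add, add_comm i j, LinearMap.mulRight_apply, map_mul (rep p e he),
      Module.End.mul_apply, rep_P] at h1
    · have h2 := op_mul_X_pow_sub_mem (K := K) (p ^ e) (j + i) (j + i) k g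
      have h3 := counit_rep_of_mem_adm p e he hy h2
      rw [if_pos le_rfl, Nat.sub_self, op_zero, LinearMap.id_apply, map_sub, map_sub, h1, zero_sub, neg_eq_zero] at h3
      exact h3
    · intro l hl hne
      have hlt : l < i := lt_of_le_of_ne (F.support.le_max' l hl) hne
      obtain ⟨z, hz, hzl⟩ := hF l
      have h2 := op_mul_X_pow_sub_mem (K := K) (p ^ e) (j + i) (j + l) k g
      rw [if_neg (by omega), sub_zero] at h2
      rw [← hzl, xi_succ, mul_assoc, ← pow_add, add_comm i j, LinearMap.mulRight_apply, map_mul (rep p e he),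
        Module.End.mul_apply, rep_P]
      exact counit_rep_of_mem_adm p e he hz h2

/-- The pairing of the Steenrod algebra with the dual algebra is faithful. -/
theorem eq_zero_of_counit_rep {x : SteenrodAlg K (p ^ e)}
    (h : ∀ g, counit K (rep p e he x g) = 0) : x = 0 := by
  obtain ⟨k, hk⟩ := exists_mem_adm x
  exact eq_zero_of_mem_adm p e he hk fun g => h _

end Faithful

/-! ### The weight filtration, with the powers ξ_t^(p^s) as independent variables. -/

section Filtration

/-- The weight of an exponent of the variables `x (t, s)`, which has weight `t + 1`. -/
def wt : (ℕ × ℕ →₀ ℕ) →+ ℕ := Finsupp.weight fun v => v.1 + 1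

theorem wt_single (v : ℕ × ℕ) (k : ℕ) : wt (Finsupp.single v k) = k * (v.1 + 1) := by
  simp [wt, Finsupp.weight_single]

variable (K : Type*) [Field K]

/-- The polynomials of weight at most `c`. -/
def weightLE (c : ℤ) : Submodule K (MvPolynomial (ℕ × ℕ) K) :=
  MvPolynomial.restrictSupport K {m | (wt m : ℤ) ≤ c}

variable {K}

theorem mem_weightLE {c : ℤ} {g : MvPolynomial (ℕ × ℕ) K} :
    g ∈ weightLE K c ↔ ∀ m ∈ g.support, (wt m : ℤ) ≤ c := Iff.rfl

theorem weightLE_mono {c d : ℤ} (h : c ≤ d) : weightLE K c ≤ weightLE K d :=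
  MvPolynomial.restrictSupport_mono K fun _ hm => le_trans (Set.mem_ofPred.mp hm) h

theorem weightLE_eq_span (c : ℤ) : weightLE K c =
    Submodule.span K ((MvPolynomial.monomial · 1) '' {m | (wt m : ℤ) ≤ c}) :=
  MvPolynomial.restrictSupport_eq_span K _

theorem monomial_mem_weightLE (m : ℕ × ℕ →₀ ℕ) (a : K) :
    MvPolynomial.monomial m a ∈ weightLE K (wt m) := by
  rw [weightLE, MvPolynomial.monomial_mem_restrictSupport]
  exact Or.inl (Set.mem_ofPred.mpr le_rfl)

theorem mul_mem_weightLE {c d : ℤ} {f g : MvPolynomial (ℕ × ℕ) K} (hf : f ∈ weightLE K c)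
    (hg : g ∈ weightLE K d) : f * g ∈ weightLE K (c + d) := by
  classical
  rw [mem_weightLE] at *
  intro m hm
  obtain ⟨a, ha, b, hb, rfl⟩ := Finset.mem_add.mp (MvPolynomial.support_mul f g hm)
  rw [map_add]
  push_cast
  exact add_le_add (hf a ha) (hg b hb)

theorem mem_weightLE_of_neg {c : ℤ} (hc : c < 0) {g : MvPolynomial (ℕ × ℕ) K}
    (hg : g ∈ weightLE K c) : g = 0 := by
  rw [← MvPolynomial.support_eq_empty, Finset.eq_empty_iff_forall_notMem]
  intro m hm
  have := mem_weightLE.mp hg m hm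
  omega

theorem exists_mem_weightLE (g : MvPolynomial (ℕ × ℕ) K) : ∃ w : ℕ, g ∈ weightLE K w :=
  ⟨g.support.sup wt, mem_weightLE.mpr fun _ hm => Int.ofNat_le.mpr (Finset.le_sup (f := wt) hm)⟩

variable (K)

/-- The polynomials in one variable all of whose coefficients have weight at most `c`. -/
def coeffLE (c : ℤ) : Submodule K (Polynomial (MvPolynomial (ℕ × ℕ) K)) :=
  ⨅ k, (weightLE K c).comap ((Polynomial.lcoeff (MvPolynomial (ℕ × ℕ) K) k).restrictScalars K)

variable {K}

theorem mem_coeffLE {c : ℤ} {g : Polynomial (MvPolynomial (ℕ × ℕ) K)} :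
    g ∈ coeffLE K c ↔ ∀ k, g.coeff k ∈ weightLE K c := by
  simp [coeffLE]

theorem coeffLE_mono {c d : ℤ} (h : c ≤ d) : coeffLE K c ≤ coeffLE K d := fun g hg => by
  rw [mem_coeffLE] at *
  exact fun k => weightLE_mono h (hg k)

theorem mul_mem_coeffLE {c d : ℤ} {f g : Polynomial (MvPolynomial (ℕ × ℕ) K)}
    (hf : f ∈ coeffLE K c) (hg : g ∈ coeffLE K d) : f * g ∈ coeffLE K (c + d) := by
  rw [mem_coeffLE] at *
  intro k
  rw [Polynomial.coeff_mul]
  exact Submodule.sum_mem _ fun i _ => mul_mem_weightLE (hf _) (hg _)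

theorem C_mem_coeffLE {c : ℤ} {g : MvPolynomial (ℕ × ℕ) K} (hg : g ∈ weightLE K c) :
    Polynomial.C g ∈ coeffLE K c := by
  rw [mem_coeffLE]
  intro k
  rw [Polynomial.coeff_C]
  split_ifs
  · exact hg
  · exact Submodule.zero_mem _

variable (K)

/-- The variables `x (t, s)` shifted by one in `t`, with `xvar 0 s = 1`. -/
def xvar : ℕ → ℕ → MvPolynomial (ℕ × ℕ) K
  | 0, _ => 1
  | t + 1, s => MvPolynomial.X (t, s)

variable {K}

theorem one_mem_weightLE : (1 : MvPolynomial (ℕ × ℕ) K) ∈ weightLE K 0 := by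
  simpa using monomial_mem_weightLE (K := K) 0 1

theorem X_mem_weightLE (v : ℕ × ℕ) : (MvPolynomial.X v : MvPolynomial (ℕ × ℕ) K) ∈ weightLE K (v.1 + 1) := by
  simpa [wt_single, MvPolynomial.X] using monomial_mem_weightLE (K := K) (Finsupp.single v 1) 1

theorem xvar_mem_weightLE (t s : ℕ) : xvar K t s ∈ weightLE K t := by
  cases t with
  | zero => simpa [xvar] using one_mem_weightLE
  | succ t => simpa [xvar] using X_mem_weightLE (K := K) (t, s)

variable (K) (p e : ℕ)

/-- The lift of the total operation to the polynomial ring on symbols for the powers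
`xi t ^ (p ^ s)`. -/
def liftOp : MvPolynomial (ℕ × ℕ) K →ₐ[K] Polynomial (MvPolynomial (ℕ × ℕ) K) :=
  MvPolynomial.aeval fun v => Polynomial.C (MvPolynomial.X v) +
    Polynomial.C (xvar K v.1 (v.2 + e)) * Polynomial.X ^ (p ^ v.2)

/-- The symbol of the total operation: its part lowering the weight by one. -/
def symbolOp : Derivation K (MvPolynomial (ℕ × ℕ) K) (Polynomial (MvPolynomial (ℕ × ℕ) K)) :=
  MvPolynomial.mkDerivation K fun v => Polynomial.C (xvar K v.1 (v.2 + e)) * Polynomial.X ^ (p ^ v.2)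

variable {K}

theorem coeffLE_X_pow (k : ℕ) {c : ℤ} {g : MvPolynomial (ℕ × ℕ) K} (hg : g ∈ weightLE K c) :
    Polynomial.C g * Polynomial.X ^ k ∈ coeffLE K c := by
  rw [mem_coeffLE]
  intro i
  rw [Polynomial.coeff_C_mul_X_pow]
  split_ifs
  · exact hg
  · exact Submodule.zero_mem _

/-- A weight bound for a polynomial together with its images under the symbol and the remainder of
the total operation. -/
def OpBound (w : ℤ) (g : MvPolynomial (ℕ × ℕ) K) : Prop :=
  g ∈ weightLE K w ∧ symbolOp K p e g ∈ coeffLE K (w - 1) ∧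
    liftOp K p e g - Polynomial.C g - symbolOp K p e g ∈ coeffLE K (w - 2)

variable {p e}

/-- The lifted operation is the identity plus a derivation plus a remainder. In a product, every
term beyond the Leibniz part contains a remainder or two symbols, so it loses at least two in
weight. -/
theorem OpBound.mul {v w : ℤ} {f g : MvPolynomial (ℕ × ℕ) K} (hf : OpBound p e v f)
    (hg : OpBound p e w g) : OpBound p e (v + w) (f * g) := by
  obtain ⟨f0, f1, f2⟩ := hf
  obtain ⟨g0, g1, g2⟩ := hg
  have f0' := C_mem_coeffLE f0
  have g0' := C_mem_coeffLE g0
  refine ⟨mul_mem_weightLE f0 g0, ?_, ?_⟩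
  · rw [Derivation.leibniz, ← Polynomial.C_mul', ← Polynomial.C_mul']
    refine Submodule.add_mem _ ?_ ?_
    · exact coeffLE_mono (by omega) (mul_mem_coeffLE f0' g1)
    · exact coeffLE_mono (by omega) (mul_mem_coeffLE g0' f1)
  · rw [Derivation.leibniz, ← Polynomial.C_mul', ← Polynomial.C_mul', map_mul, map_mul]
    generalize symbolOp K p e f = Df at *
    generalize symbolOp K p e g = Dg at *
    generalize liftOp K p e f = Tf at *
    generalize liftOp K p e g = Tg at *
    have : Tf * Tg - Polynomial.C f * Polynomial.C g - (Polynomial.C f * Dg + Polynomial.C g * Df) =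
        Polynomial.C f * (Tg - Polynomial.C g - Dg) + (Df * Dg + (Df * (Tg - Polynomial.C g - Dg) +
          ((Tf - Polynomial.C f - Df) * Polynomial.C g + ((Tf - Polynomial.C f - Df) * Dg +
            (Tf - Polynomial.C f - Df) * (Tg - Polynomial.C g - Dg))))) := by ring
    rw [this]
    refine Submodule.add_mem _ (coeffLE_mono (by omega) (mul_mem_coeffLE f0' g2)) ?_
    refine Submodule.add_mem _ (coeffLE_mono (by omega) (mul_mem_coeffLE f1 g1)) ?_
    refine Submodule.add_mem _ (coeffLE_mono (by omega) (mul_mem_coeffLE f1 g2)) ?_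
    refine Submodule.add_mem _ (coeffLE_mono (by omega) (mul_mem_coeffLE f2 g0')) ?_
    refine Submodule.add_mem _ (coeffLE_mono (by omega) (mul_mem_coeffLE f2 g1)) ?_
    exact coeffLE_mono (by omega) (mul_mem_coeffLE f2 g2)

theorem opBound_one : OpBound p e 0 (1 : MvPolynomial (ℕ × ℕ) K) := by
  refine ⟨one_mem_weightLE, ?_, ?_⟩ <;> simp

theorem opBound_X (v : ℕ × ℕ) : OpBound p e (v.1 + 1) (MvPolynomial.X v : MvPolynomial (ℕ × ℕ) K) := by
  refine ⟨X_mem_weightLE v, ?_, ?_⟩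
  · rw [symbolOp, MvPolynomial.mkDerivation_X]
    exact coeffLE_X_pow _ (weightLE_mono (by omega) (xvar_mem_weightLE _ _))
  · simp [symbolOp, liftOp]

theorem opBound_monomial (m : ℕ × ℕ →₀ ℕ) :
    OpBound p e (wt m) (MvPolynomial.monomial m (1 : K)) := by
  induction m using Finsupp.induction_linear with
  | zero => simpa using opBound_one (K := K) (p := p) (e := e)
  | add m n hm hn =>
    rw [map_add, ← one_mul (1 : K), ← MvPolynomial.monomial_mul]
    push_cast
    exact hm.mul hn
  | single v k =>
    rw [wt_single]
    induction k with
    | zero => simpa using opBound_one (K := K) (p := p) (e := e)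
    | succ k ih =>
      rw [Finsupp.single_add, ← one_mul (1 : K), ← MvPolynomial.monomial_mul]
      have := ih.mul (opBound_X (K := K) (p := p) (e := e) v)
      rw [MvPolynomial.X] at this
      convert this using 1
      push_cast
      ring

theorem opBound_of_mem {w : ℤ} {g : MvPolynomial (ℕ × ℕ) K} (hg : g ∈ weightLE K w) :
    OpBound p e w g := by
  rw [weightLE_eq_span] at hg
  induction hg using Submodule.span_induction with
  | mem g h =>
    obtain ⟨m, hm, rfl⟩ := h
    have hm' : (wt m : ℤ) ≤ w := hm
    obtain ⟨h0, h1, h2⟩ := opBound_monomial (K := K) (p := p) (e := e) m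
    exact ⟨weightLE_mono hm' h0, coeffLE_mono (by omega) h1, coeffLE_mono (by omega) h2⟩
  | zero => refine ⟨?_, ?_, ?_⟩ <;> simp
  | add f g _ _ hf hg =>
    obtain ⟨f0, f1, f2⟩ := hf
    obtain ⟨g0, g1, g2⟩ := hg
    refine ⟨Submodule.add_mem _ f0 g0, ?_, ?_⟩
    · rw [map_add]; exact Submodule.add_mem _ f1 g1
    · rw [map_add, map_add, map_add]
      convert Submodule.add_mem _ f2 g2 using 1
      ring
  | smul c g _ hg =>
    obtain ⟨g0, g1, g2⟩ := hg
    refine ⟨Submodule.smul_mem _ c g0, ?_, ?_⟩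
    · rw [Derivation.map_smul]; exact Submodule.smul_mem _ c g1
    · rw [Derivation.map_smul, map_smul, ← Polynomial.smul_C, ← smul_sub, ← smul_sub]
      exact Submodule.smul_mem _ c g2

variable (p e)

/-- The lift of the action of `P^r`, `r > 0`, lowers the weight. -/
theorem coeff_liftOp_mem {w : ℤ} {g : MvPolynomial (ℕ × ℕ) K} (hg : g ∈ weightLE K w) {r : ℕ}
    (hr : r ≠ 0) : (liftOp K p e g).coeff r ∈ weightLE K (w - 1) := by
  obtain ⟨_, h1, h2⟩ := opBound_of_mem (p := p) (e := e) hg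
  have h3 := Submodule.add_mem _ (coeffLE_mono (show w - 2 ≤ w - 1 by omega) h2) h1
  have h4 := mem_coeffLE.mp h3 r
  simpa [Polynomial.coeff_C, hr] using h4

theorem coeff_liftOp_sub_mem {w : ℤ} {g : MvPolynomial (ℕ × ℕ) K} (hg : g ∈ weightLE K w) {r : ℕ}
    (hr : r ≠ 0) : (liftOp K p e g).coeff r - (symbolOp K p e g).coeff r ∈ weightLE K (w - 2) := by
  have h2 := mem_coeffLE.mp (opBound_of_mem (p := p) (e := e) hg).2.2 r
  simpa [Polynomial.coeff_C, hr] using h2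

variable (K)

/-- The evaluation `x (t, s) ↦ xi (t + 1) ^ (p ^ s)`. -/
def powEval : MvPolynomial (ℕ × ℕ) K →ₐ[K] MvPolynomial ℕ K :=
  MvPolynomial.aeval fun v => MvPolynomial.X v.1 ^ (p ^ v.2)

variable {K}

theorem powEval_xvar (t s : ℕ) : powEval K p (xvar K t s) = xi K t ^ (p ^ s) := by
  cases t <;> simp [xvar, powEval]

/-- By Frobenius, ξ_{t+1}^(p^s) goes to ξ_{t+1}^(p^s) + ξ_t^(p^(s+e)) X^(p^s), which is the formula
defining the lift. -/
theorem op_powEval [Fact p.Prime] [CharP K p] (r : ℕ) (g : MvPolynomial (ℕ × ℕ) K) :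
    op K (p ^ e) r (powEval K p g) = powEval K p ((liftOp K p e g).coeff r) := by
  have h : (totalOp K (p ^ e)).comp (powEval K p) =
      (Polynomial.mapAlgHom (powEval K p)).comp (liftOp K p e) := by
    ext1 v
    simp only [AlgHom.comp_apply, liftOp, MvPolynomial.aeval_X, map_add, map_mul, map_pow,
      Polynomial.coe_mapAlgHom, Polynomial.map_C, Polynomial.map_X, AlgHom.coe_toRingHom,
      powEval_xvar]
    simp only [powEval, MvPolynomial.aeval_X, map_pow, totalOp_X, add_pow_char_pow, mul_pow]
    rw [← pow_mul, ← pow_add, add_comm e]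
  have := congrArg (fun F => (F g).coeff r) h
  simpa [op_apply] using this

variable (K)

/-- The weight filtration of the dual algebra. -/
def dualFiltration (c : ℤ) : Submodule K (MvPolynomial ℕ K) :=
  (weightLE K c).map (powEval K p).toLinearMap

variable {K}

theorem powEval_mem {c : ℤ} {g : MvPolynomial (ℕ × ℕ) K} (hg : g ∈ weightLE K c) :
    powEval K p g ∈ dualFiltration K p c := ⟨g, hg, rfl⟩

theorem dualFiltration_mono {c d : ℤ} (h : c ≤ d) : dualFiltration K p c ≤ dualFiltration K p d :=
  Submodule.map_mono (weightLE_mono h)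

theorem dualFiltration_of_neg {c : ℤ} (hc : c < 0) {f : MvPolynomial ℕ K}
    (hf : f ∈ dualFiltration K p c) : f = 0 := by
  obtain ⟨g, hg, rfl⟩ := hf
  rw [mem_weightLE_of_neg hc hg, map_zero]

theorem powEval_surjective : Function.Surjective (powEval K p) := by
  rw [← AlgHom.range_eq_top, eq_top_iff, ← MvPolynomial.adjoin_range_X, Algebra.adjoin_le_iff]
  rintro _ ⟨t, rfl⟩
  exact ⟨MvPolynomial.X (t, 0), by simp [powEval]⟩

theorem exists_mem_dualFiltration (f : MvPolynomial ℕ K) : ∃ w : ℕ, f ∈ dualFiltration K p w := by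
  obtain ⟨g, rfl⟩ := powEval_surjective p f
  obtain ⟨w, hw⟩ := exists_mem_weightLE g
  exact ⟨w, powEval_mem p hw⟩

variable [Fact p.Prime] [CharP K p]

theorem op_mem_dualFiltration {c : ℤ} {f : MvPolynomial ℕ K} (hf : f ∈ dualFiltration K p c) {r : ℕ}
    (hr : r ≠ 0) : op K (p ^ e) r f ∈ dualFiltration K p (c - 1) := by
  obtain ⟨g, hg, rfl⟩ := hf
  rw [AlgHom.toLinearMap_apply, op_powEval]
  exact powEval_mem p (coeff_liftOp_mem p e hg hr)

theorem rep_sub_aug_mem (he : 1 ≤ e) (x : SteenrodAlg K (p ^ e)) {c : ℤ} {f : MvPolynomial ℕ K}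
    (hf : f ∈ dualFiltration K p c) :
    rep p e he x f - aug K (p ^ e) x • f ∈ dualFiltration K p (c - 1) := by
  obtain ⟨x, rfl⟩ := mk_surjective x
  have hle : dualFiltration K p (c - 1) ≤ dualFiltration K p c := dualFiltration_mono p (by omega)
  induction x using FreeAlgebra.induction generalizing f with
  | grade0 r =>
    rw [AlgHom.commutes, AlgHom.commutes, AlgHom.commutes, Module.algebraMap_end_apply]
    simp
  | grade1 r =>
    change rep p e he (P K (p ^ e) r) f - aug K (p ^ e) (P K (p ^ e) r) • f ∈ _
    rw [rep_P, aug_P]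
    split_ifs with hr
    · simp [hr, op_zero]
    · simpa using op_mem_dualFiltration p e hf hr
  | mul x y hx hy =>
    have h1 := hy hf
    have h2 : rep p e he (mk K (p ^ e) y) f ∈ dualFiltration K p c := by
      rw [← sub_add_cancel (rep p e he (mk K (p ^ e) y) f) (aug K (p ^ e) (mk K (p ^ e) y) • f)]
      exact Submodule.add_mem _ (hle h1) (Submodule.smul_mem _ _ hf)
    have h3 := hx h2
    have h4 := Submodule.add_mem _ h3 (Submodule.smul_mem _ (aug K (p ^ e) (mk K (p ^ e) x)) h1)
    rw [map_mul, map_mul, map_mul, Module.End.mul_apply]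
    convert h4 using 1
    rw [smul_sub, mul_smul]
    abel
  | add x y hx hy =>
    rw [map_add, map_add, map_add, LinearMap.add_apply, add_smul, add_sub_add_comm]
    exact Submodule.add_mem _ (hx hf) (hy hf)

theorem rep_mem_dualFiltration (he : 1 ≤ e) (k : ℕ) {x : SteenrodAlg K (p ^ e)}
    (hx : x ∈ (RingHom.ker (aug K (p ^ e)) : Ideal _) ^ k) {c : ℤ} {f : MvPolynomial ℕ K}
    (hf : f ∈ dualFiltration K p c) : rep p e he x f ∈ dualFiltration K p (c - k) := by
  induction k generalizing x c f with
  | zero =>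
    rw [← sub_add_cancel (rep p e he x f) (aug K (p ^ e) x • f)]
    exact Submodule.add_mem _ (dualFiltration_mono p (by simp) (rep_sub_aug_mem p e he x hf))
      (Submodule.smul_mem _ _ (by simpa using hf))
  | succ k ih =>
    rw [Submodule.pow_succ] at hx
    induction hx using Submodule.mul_induction_on' with
    | mem_mul_mem x hx y hy =>
      rw [map_mul, Module.End.mul_apply]
      have h1 := rep_sub_aug_mem p e he y hf
      rw [show aug K (p ^ e) y = 0 from hy, zero_smul, sub_zero] at h1
      have := ih hx h1
      convert this using 2
      push_cast
      ring
    | add x _ y _ hx hy =>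
      rw [map_add, LinearMap.add_apply]
      exact Submodule.add_mem _ hx hy

end Filtration

/-! ### Base-p digits: reduced exponents minimise weight. -/

section Digits

variable (p : ℕ)

/-- The exponent of `∏ xi (t + 1) ^ (m (t, s) * p ^ s)`. -/
def expo : (ℕ × ℕ →₀ ℕ) →+ (ℕ →₀ ℕ) :=
  Finsupp.liftAddHom fun v => (Finsupp.singleAddHom v.1).comp (AddMonoidHom.mulRight (p ^ v.2))

theorem expo_single (v : ℕ × ℕ) (k : ℕ) :
    expo p (Finsupp.single v k) = Finsupp.single v.1 (k * p ^ v.2) := by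
  simp [expo]

theorem expo_apply (m : ℕ × ℕ →₀ ℕ) (t L : ℕ) (h : ∀ s, L ≤ s → m (t, s) = 0) :
    expo p m t = ∑ s ∈ Finset.range L, m (t, s) * p ^ s := by
  induction m using Finsupp.induction_linear with
  | zero => simp
  | add m n hm hn =>
    have h' : ∀ s, L ≤ s → m (t, s) = 0 ∧ n (t, s) = 0 := fun s hs => by
      have := h s hs
      rw [Finsupp.add_apply] at this
      omega
    rw [map_add, Finsupp.add_apply, hm fun s hs => (h' s hs).1, hn fun s hs => (h' s hs).2,
      ← Finset.sum_add_distrib]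
    exact Finset.sum_congr rfl fun s _ => by rw [Finsupp.add_apply, add_mul]
  | single v k =>
    obtain ⟨a, b⟩ := v
    rw [expo_single]
    by_cases hat : a = t
    · subst hat
      rw [Finsupp.single_eq_same]
      by_cases hb : b < L
      · rw [Finset.sum_eq_single_of_mem b (Finset.mem_range.mpr hb)]
        · simp
        · intro s _ hs
          rw [Finsupp.single_eq_of_ne (by simpa using hs), zero_mul]
      · have hk := h b (not_lt.mp hb)
        rw [Finsupp.single_eq_same] at hk
        subst hk
        simp
    · rw [Finsupp.single_eq_of_ne (Ne.symm hat), Finset.sum_eq_zero]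
      intro s _
      rw [Finsupp.single_eq_of_ne (fun h => hat (Prod.ext_iff.mp h).1.symm), zero_mul]

variable {p}

theorem sum_digits_lt (L : ℕ) (d : ℕ → ℕ) (hd : ∀ s, d s < p) :
    ∑ s ∈ Finset.range L, d s * p ^ s < p ^ L := by
  induction L with
  | zero => simp
  | succ L ih =>
    rw [Finset.sum_range_succ]
    have : (d L + 1) * p ^ L ≤ p * p ^ L := Nat.mul_le_mul_right _ (hd L)
    rw [pow_succ']
    linarith

theorem digits_unique (L : ℕ) (d d' : ℕ → ℕ) (hd : ∀ s, d s < p) (hd' : ∀ s, d' s < p)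
    (h : ∑ s ∈ Finset.range L, d s * p ^ s = ∑ s ∈ Finset.range L, d' s * p ^ s) :
    ∀ s < L, d s = d' s := by
  induction L with
  | zero => intro s hs; omega
  | succ L ih =>
    have h1 := sum_digits_lt L d hd
    have h2 := sum_digits_lt L d' hd'
    rw [Finset.sum_range_succ, Finset.sum_range_succ] at h
    have h3 : d L = d' L := by
      have := congrArg (· / p ^ L) h
      simpa [Nat.add_mul_div_right _ _ (Nat.zero_lt_of_lt h1), Nat.div_eq_of_lt h1, Nat.div_eq_of_lt h2] using this
    rw [h3] at h
    intro s hs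
    rcases Nat.lt_succ_iff_lt_or_eq.mp hs with hs | rfl
    · exact ih (Nat.add_right_cancel h) s hs
    · exact h3

theorem eq_of_expo_eq {m n : ℕ × ℕ →₀ ℕ} (hm : ∀ v, m v < p) (hn : ∀ v, n v < p)
    (h : expo p m = expo p n) : m = n := by
  ext ⟨t, s⟩
  set L := max (s + 1) ((m.support.sup Prod.snd) ⊔ (n.support.sup Prod.snd) + 1) with hL
  have hb : ∀ s, L ≤ s → m (t, s) = 0 ∧ n (t, s) = 0 := fun s hs => by
    constructor
    · by_contra hne
      have := Finset.le_sup (f := Prod.snd) (Finsupp.mem_support_iff.mpr hne)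
      simp only at this
      omega
    · by_contra hne
      have := Finset.le_sup (f := Prod.snd) (Finsupp.mem_support_iff.mpr hne)
      simp only at this
      omega
  have h' := DFunLike.congr_fun h t
  rw [expo_apply p m t L fun s hs => (hb s hs).1, expo_apply p n t L fun s hs => (hb s hs).2] at h'
  exact digits_unique L (fun s => m (t, s)) (fun s => n (t, s)) (fun _ => hm _) (fun _ => hn _) h' s
    (by omega)

/-- A carry trades p copies of x (t, s) for one x (t, s + 1), lowering the weight by (p - 1)(t + 1).
-/
theorem exists_carry (hp : 1 < p) {m : ℕ × ℕ →₀ ℕ} {v : ℕ × ℕ} (hv : p ≤ m v) :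
    ∃ m', expo p m' = expo p m ∧ wt m' < wt m := by
  have hle : Finsupp.single v p ≤ m := by simpa using hv
  refine ⟨m - Finsupp.single v p + Finsupp.single (v.1, v.2 + 1) 1, ?_, ?_⟩
  · nth_rewrite 2 [← tsub_add_cancel_of_le hle]
    rw [map_add, map_add, expo_single, expo_single, one_mul, pow_succ']
  · nth_rewrite 2 [← tsub_add_cancel_of_le hle]
    rw [map_add, map_add, wt_single, wt_single]
    have : 1 * (v.1 + 1) < p * (v.1 + 1) := Nat.mul_lt_mul_of_pos_right hp (Nat.succ_pos _)
    omega

/-- Repeated carrying strictly lowers the weight until it stops at a reduced exponent, which is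
unique by uniqueness of digits. -/
theorem wt_minimal (hp : 1 < p) {m n : ℕ × ℕ →₀ ℕ} (hn : ∀ v, n v < p)
    (h : expo p m = expo p n) : wt n ≤ wt m ∧ (wt m = wt n → m = n) := by
  induction hw : wt m using Nat.strong_induction_on generalizing m with
  | _ w ih =>
    by_cases hm : ∀ v, m v < p
    · have := eq_of_expo_eq hm hn h
      subst this
      exact ⟨hw.le, fun _ => rfl⟩
    · push Not at hm
      obtain ⟨v, hv⟩ := hm
      obtain ⟨m', h1, h2⟩ := exists_carry hp hv
      have := (ih (wt m') (hw ▸ h2) (h1.trans h) rfl).1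
      exact ⟨by omega, fun h => by omega⟩

theorem exists_reduced (hp : 1 < p) (r : ℕ →₀ ℕ) : ∃ m, (∀ v, m v < p) ∧ expo p m = r := by
  have h1 : ∃ m, expo p m = r := by
    induction r using Finsupp.induction_linear with
    | zero => exact ⟨0, map_zero _⟩
    | add r s hr hs =>
      obtain ⟨m, rfl⟩ := hr
      obtain ⟨n, rfl⟩ := hs
      exact ⟨m + n, map_add _ _ _⟩
    | single t k => exact ⟨Finsupp.single (t, 0) k, by simp [expo_single]⟩
  obtain ⟨m, rfl⟩ := h1
  induction hw : wt m using Nat.strong_induction_on generalizing m with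
  | _ w ih =>
    by_cases hm : ∀ v, m v < p
    · exact ⟨m, hm, rfl⟩
    · push Not at hm
      obtain ⟨v, hv⟩ := hm
      obtain ⟨m', h1, h2⟩ := exists_carry hp hv
      rw [← h1]
      exact ih (wt m') (hw ▸ h2) m' rfl

variable (p) (e N : ℕ)

/-- The exponents of the monomials in the `x (t, s)`, `s < e * (N - t)`, that are reduced, i.e.
truncated at height `p`. -/
def Reduced (m : ℕ × ℕ →₀ ℕ) : Prop := (∀ v, m v < p) ∧ ∀ v ∈ m.support, v.2 < e * (N - v.1)

variable {p e N}

theorem Reduced.expo_lt {m : ℕ × ℕ →₀ ℕ} (h : Reduced p e N m) (t : ℕ) :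
    expo p m t < p ^ (e * (N - t)) := by
  rw [expo_apply p m t (e * (N - t))]
  · exact sum_digits_lt _ _ fun s => h.1 _
  · intro s hs
    by_contra hne
    have := h.2 _ (Finsupp.mem_support_iff.mpr hne)
    simp only at this
    omega

theorem pow_le_expo {m : ℕ × ℕ →₀ ℕ} {v : ℕ × ℕ} (hv : v ∈ m.support) : p ^ v.2 ≤ expo p m v.1 := by
  have hle : Finsupp.single v 1 ≤ m := by
    simpa [Nat.one_le_iff_ne_zero] using Finsupp.mem_support_iff.mp hv
  rw [← tsub_add_cancel_of_le hle, map_add, expo_single, Finsupp.add_apply]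
  simp

end Digits

/-! ### The truncation ideal and its stability. -/

section Truncation

variable (K : Type*) [Field K] (p e N : ℕ)

/-- The ideal generated by the powers `xi (t + 1) ^ (p ^ (e * (N - t)))`. -/
def truncIdeal : Ideal (MvPolynomial ℕ K) :=
  Ideal.span ((fun r => MvPolynomial.monomial r (1 : K)) ''
    Set.range fun t => Finsupp.single t (p ^ (e * (N - t))))

variable {K p e N}

theorem mem_truncIdeal {f : MvPolynomial ℕ K} :
    f ∈ truncIdeal K p e N ↔ ∀ r ∈ f.support, ∃ t, p ^ (e * (N - t)) ≤ r t := by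
  simp [truncIdeal, MvPolynomial.mem_ideal_span_monomial_image]

theorem X_pow_mem_truncIdeal {t k : ℕ} (h : p ^ (e * (N - t)) ≤ k) :
    (MvPolynomial.X t ^ k : MvPolynomial ℕ K) ∈ truncIdeal K p e N := by
  rw [mem_truncIdeal, MvPolynomial.X_pow_eq_monomial]
  intro r hr
  have := MvPolynomial.support_monomial_subset hr
  rw [Finset.mem_singleton.mp this]
  exact ⟨t, by simpa using h⟩

theorem counit_of_mem_truncIdeal (hp : 0 < p) {f : MvPolynomial ℕ K} (hf : f ∈ truncIdeal K p e N) :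
    counit K f = 0 := by
  have : truncIdeal K p e N ≤ RingHom.ker (counit K) := by
    refine Ideal.span_le.mpr ?_
    rintro _ ⟨_, ⟨t, rfl⟩, rfl⟩
    simp [counit, RingHom.mem_ker, MvPolynomial.aeval_monomial, hp.ne']
  exact this hf

/-- A generator ξ_{t+1}^M goes to itself plus ξ_t^(qM) X^M. For t > 0 the second coefficient is
again in the ideal; for t = 0 it sits in degree p^(eN), beyond r. When t ≥ N the truncated
subtraction makes the generator ξ_{t+1} itself. -/
theorem op_mem_truncIdeal [Fact p.Prime] [CharP K p] {f : MvPolynomial ℕ K}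
    (hf : f ∈ truncIdeal K p e N) {r : ℕ} (hr : r < p ^ (e * N)) :
    op K (p ^ e) r f ∈ truncIdeal K p e N := by
  have hp : 0 < p := (Fact.out : p.Prime).pos
  have h : truncIdeal K p e N ≤ (Ideal.map Polynomial.C (truncIdeal K p e N) ⊔
      Ideal.span {Polynomial.X ^ p ^ (e * N)}).comap (totalOp K (p ^ e)) := by
    refine Ideal.span_le.mpr ?_
    rintro _ ⟨_, ⟨t, rfl⟩, rfl⟩
    simp only [Ideal.coe_comap, Set.mem_preimage, SetLike.mem_coe]
    rw [← MvPolynomial.X_pow_eq_monomial, map_pow, totalOp_X, add_pow_char_pow, mul_pow, ← map_pow, ← map_pow,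
      ← pow_mul]
    refine Ideal.add_mem _ (Ideal.mem_sup_left (Ideal.mem_map_of_mem _
      (X_pow_mem_truncIdeal le_rfl))) ?_
    cases t with
    | zero => exact Ideal.mul_mem_left _ _ (Ideal.mem_sup_right (Ideal.mem_span_singleton_self _))
    | succ t =>
      refine Ideal.mul_mem_right _ _ (Ideal.mem_sup_left (Ideal.mem_map_of_mem _ ?_))
      rw [xi_succ]
      refine X_pow_mem_truncIdeal ?_
      rw [← pow_add]
      refine Nat.pow_le_pow_right hp ?_
      have := Nat.mul_le_mul_left e (show N - t ≤ 1 + (N - (t + 1)) by omega)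
      linarith
  obtain ⟨a, ha, b, hb, hab⟩ := Submodule.mem_sup.mp (h hf)
  obtain ⟨c, rfl⟩ := Ideal.mem_span_singleton.mp hb
  rw [op_apply, ← hab, Polynomial.coeff_add, mul_comm, Polynomial.coeff_mul_X_pow', if_neg (by omega), add_zero]
  exact Ideal.mem_map_C_iff.mp ha r

end Truncation

/-! ### Weight measured on reduced monomials only. -/

section ReducedFiltration

variable (K : Type*) [Field K] (p e N : ℕ)

/-- The polynomials whose reduced monomials have weight at most `c`. -/
def reducedLE (c : ℤ) : Submodule K (MvPolynomial (ℕ × ℕ) K) :=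
  MvPolynomial.restrictSupport K {m | Reduced p e N m → (wt m : ℤ) ≤ c}

/-- The ideal spanned by the monomials that are not reduced. -/
def nonreduced : Ideal (MvPolynomial (ℕ × ℕ) K) :=
  Ideal.span ((fun m => MvPolynomial.monomial m (1 : K)) ''
    {m | ∃ v, m = Finsupp.single v p ∨ (e * (N - v.1) ≤ v.2 ∧ m = Finsupp.single v 1)})

variable {K p e N}

theorem mem_reducedLE {c : ℤ} {g : MvPolynomial (ℕ × ℕ) K} :
    g ∈ reducedLE K p e N c ↔ ∀ m ∈ g.support, Reduced p e N m → (wt m : ℤ) ≤ c := Iff.rfl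

theorem not_reduced_iff {m : ℕ × ℕ →₀ ℕ} :
    ¬ Reduced p e N m ↔ (∃ v, p ≤ m v) ∨ ∃ v ∈ m.support, e * (N - v.1) ≤ v.2 := by
  rw [Reduced, not_and_or]
  push Not
  rfl

theorem mem_nonreduced {g : MvPolynomial (ℕ × ℕ) K} :
    g ∈ nonreduced K p e N ↔ ∀ m ∈ g.support, ¬ Reduced p e N m := by
  rw [nonreduced, MvPolynomial.mem_ideal_span_monomial_image]
  refine forall₂_congr fun m _ => ?_
  rw [not_reduced_iff]
  constructor
  · rintro ⟨_, ⟨v, rfl | ⟨hv, rfl⟩⟩, hle⟩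
    · exact Or.inl ⟨v, by simpa using hle⟩
    · refine Or.inr ⟨v, ?_, hv⟩
      have := hle v
      rw [Finsupp.single_eq_same] at this
      exact Finsupp.mem_support_iff.mpr (by omega)
  · rintro (⟨v, hv⟩ | ⟨v, hv, hv'⟩)
    · exact ⟨_, ⟨v, Or.inl rfl⟩, by simpa using hv⟩
    · exact ⟨_, ⟨v, Or.inr ⟨hv', rfl⟩⟩, by
        simpa [Nat.one_le_iff_ne_zero] using Finsupp.mem_support_iff.mp hv⟩

theorem nonreduced_le (c : ℤ) {g : MvPolynomial (ℕ × ℕ) K} (hg : g ∈ nonreduced K p e N) :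
    g ∈ reducedLE K p e N c :=
  mem_reducedLE.mpr fun m hm h => absurd h (mem_nonreduced.mp hg m hm)

theorem weightLE_le_reducedLE (c : ℤ) : weightLE K c ≤ reducedLE K p e N c :=
  MvPolynomial.restrictSupport_mono K fun _ hm _ => hm

theorem reducedLE_le {c : ℤ} {S : Submodule K (MvPolynomial (ℕ × ℕ) K)}
    (h1 : weightLE K c ≤ S) (h2 : ∀ g ∈ nonreduced K p e N, g ∈ S) : reducedLE K p e N c ≤ S := by
  rw [reducedLE, MvPolynomial.restrictSupport_eq_span, Submodule.span_le]
  rintro _ ⟨m, hm, rfl⟩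
  by_cases hr : Reduced p e N m
  · exact h1 (weightLE_mono (hm hr) (monomial_mem_weightLE m 1))
  · refine h2 _ (mem_nonreduced.mpr fun n hn => ?_)
    rwa [Finset.mem_singleton.mp (MvPolynomial.support_monomial_subset hn)]

theorem mul_mem_reducedLE {c d : ℤ} {f g : MvPolynomial (ℕ × ℕ) K} (hf : f ∈ weightLE K d)
    (hg : g ∈ reducedLE K p e N c) : f * g ∈ reducedLE K p e N (c + d) := by
  have : reducedLE K p e N c ≤ (reducedLE K p e N (c + d)).comap (LinearMap.mulLeft K f) :=
    reducedLE_le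
      (fun g hg => weightLE_le_reducedLE _ (by
        rw [LinearMap.mulLeft_apply, add_comm]; exact mul_mem_weightLE hf hg))
      fun g hg => nonreduced_le _ (Ideal.mul_mem_left _ f hg)
  exact this hg

theorem X_mem_nonreduced {v : ℕ × ℕ} (hv : e * (N - v.1) ≤ v.2) :
    (MvPolynomial.X v : MvPolynomial (ℕ × ℕ) K) ∈ nonreduced K p e N :=
  Ideal.subset_span ⟨_, ⟨v, Or.inr ⟨hv, rfl⟩⟩, rfl⟩

end ReducedFiltration

/-! ### Leading-order derivations, their commutators, and detection of weight. -/

section Derivations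

variable (K : Type*) [Field K]

/-- The derivation `x (t, i) ↦ x (t - d, i + e * d)`. -/
def shift (e d i : ℕ) : Derivation K (MvPolynomial (ℕ × ℕ) K) (MvPolynomial (ℕ × ℕ) K) :=
  MvPolynomial.mkDerivation K fun v =>
    if v.2 = i ∧ d ≤ v.1 + 1 then xvar K (v.1 + 1 - d) (i + e * d) else 0

variable {K} {p e N : ℕ}

theorem shift_X (d i : ℕ) (v : ℕ × ℕ) : shift K e d i (MvPolynomial.X v) =
    if v.2 = i ∧ d ≤ v.1 + 1 then xvar K (v.1 + 1 - d) (i + e * d) else 0 := by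
  rw [shift, MvPolynomial.mkDerivation_X]

theorem shift_xvar {d : ℕ} (hd : 1 ≤ d) (i t s : ℕ) : shift K e d i (xvar K t s) =
    if s = i ∧ d ≤ t then xvar K (t - d) (i + e * d) else 0 := by
  cases t with
  | zero => rw [xvar, Derivation.map_one_eq_zero, if_neg (by omega)]
  | succ t => rw [xvar, shift_X]

theorem coeff_symbolOp (hp : 1 < p) (i : ℕ) (g : MvPolynomial (ℕ × ℕ) K) :
    (symbolOp K p e g).coeff (p ^ i) = shift K e 1 i g := by
  have h : (Polynomial.lcoeff (MvPolynomial (ℕ × ℕ) K) (p ^ i)).compDer (symbolOp K p e) =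
      shift K e 1 i := by
    refine MvPolynomial.derivation_ext fun v => ?_
    rw [shift_X]
    change (symbolOp K p e (MvPolynomial.X v)).coeff (p ^ i) = _
    rw [symbolOp, MvPolynomial.mkDerivation_X, Polynomial.coeff_C_mul_X_pow]
    by_cases hv : v.2 = i
    · subst hv; simp
    · rw [if_neg fun h => hv (Nat.pow_right_injective hp h).symm, if_neg fun h => hv h.1]
  exact DFunLike.congr_fun h g

/-- On a variable only one order of composition survives: after `shift K e d (i + e)` the second
index exceeds i, so `shift K e 1 i` kills the result. -/
theorem shift_succ (he : 1 ≤ e) {d : ℕ} (hd : 1 ≤ d) (i : ℕ) (g : MvPolynomial (ℕ × ℕ) K) :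
    shift K e (d + 1) i g =
      shift K e d (i + e) (shift K e 1 i g) - shift K e 1 i (shift K e d (i + e) g) := by
  rw [← Derivation.commutator_apply]
  refine DFunLike.congr_fun (MvPolynomial.derivation_ext fun v => ?_) g
  have hed : 1 ≤ e * d := Nat.mul_pos he hd
  have h2 : shift K e 1 i (shift K e d (i + e) (MvPolynomial.X v)) = 0 := by
    rw [shift_X]
    split_ifs
    · rw [shift_xvar le_rfl, if_neg (by omega)]
    · exact map_zero _
  rw [Derivation.commutator_apply, h2, sub_zero, shift_X, shift_X]
  by_cases hv : v.2 = i
  · rw [if_pos (show v.2 = i ∧ 1 ≤ v.1 + 1 from ⟨hv, by omega⟩), shift_xvar hd]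
    by_cases hdv : d ≤ v.1
    · rw [if_pos ⟨hv, by omega⟩, if_pos ⟨by omega, by omega⟩]
      congr 1
      · omega
      · ring
    · rw [if_neg (by omega), if_neg (by omega)]
  · rw [if_neg (by tauto), if_neg (by tauto), map_zero]

theorem derivation_mem_of_span {R : Type*} [CommRing R] [Algebra K R] (D : Derivation K R R) {S : Set R}
    (h : ∀ s ∈ S, D s ∈ Ideal.span S) {f : R} (hf : f ∈ Ideal.span S) : D f ∈ Ideal.span S := by
  induction hf using Submodule.span_induction with
  | mem f hf => exact h f hf
  | zero => simp
  | add f g _ _ hf hg => rw [map_add]; exact Ideal.add_mem _ hf hg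
  | smul a f hf' hf =>
    rw [smul_eq_mul, Derivation.leibniz, smul_eq_mul, smul_eq_mul]
    exact Ideal.add_mem _ (Ideal.mul_mem_left _ _ hf) (Ideal.mul_mem_right _ _ hf')

theorem xvar_mem_nonreduced {t s : ℕ} (ht : t ≠ 0) (h : e * (N - (t - 1)) ≤ s) :
    xvar K t s ∈ nonreduced K p e N := by
  obtain ⟨t, rfl⟩ := Nat.exists_eq_succ_of_ne_zero ht
  exact X_mem_nonreduced h

/-- Derivations kill p-th powers. A variable outside the allowed range moves to another such
variable, unless it is sent to 1; the bound on i + ed excludes this. -/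
theorem shift_mem_nonreduced [CharP K p] {d i : ℕ} (hd : 1 ≤ d) (hi : i + e * d < e * (N + 1))
    {g : MvPolynomial (ℕ × ℕ) K} (hg : g ∈ nonreduced K p e N) :
    shift K e d i g ∈ nonreduced K p e N := by
  refine derivation_mem_of_span _ ?_ hg
  rintro _ ⟨m, ⟨v, rfl | ⟨hv, rfl⟩⟩, rfl⟩
  · simp only
    rw [← MvPolynomial.X_pow_eq_monomial, Derivation.leibniz_pow, ← Nat.cast_smul_eq_nsmul K,
      CharP.cast_eq_zero, zero_smul]
    exact Ideal.zero_mem _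
  · change shift K e d i (MvPolynomial.X v) ∈ nonreduced K p e N
    rw [shift_X]
    split_ifs with h
    · obtain ⟨h1, h2⟩ := h
      have h3 : v.1 + 1 - d ≠ 0 := fun h0 => by
        have := Nat.mul_le_mul_left e (show N + 1 ≤ N - v.1 + d by omega)
        rw [mul_add e (N - v.1)] at this
        omega
      refine xvar_mem_nonreduced h3 ?_
      have := Nat.mul_le_mul_left e (show N - (v.1 + 1 - d - 1) ≤ N - v.1 + d by omega)
      rw [mul_add e (N - v.1)] at this
      omega
    · exact Ideal.zero_mem _

theorem shift_mem_weightLE {d i : ℕ} {c : ℤ} {g : MvPolynomial (ℕ × ℕ) K} (hg : g ∈ weightLE K c) :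
    shift K e d i g ∈ weightLE K (c - d) := by
  have : weightLE K c ≤ (weightLE K (c - d)).comap (shift K e d i : _ →ₗ[K] _) := by
    rw [weightLE_eq_span, Submodule.span_le]
    rintro _ ⟨m, hm, rfl⟩
    have hm' : (wt m : ℤ) ≤ c := hm
    simp only [Submodule.comap_coe, Set.mem_preimage, SetLike.mem_coe, Derivation.coeFn_coe]
    rw [shift, MvPolynomial.mkDerivation_monomial, one_smul]
    refine Submodule.sum_mem _ fun v hv => ?_
    beta_reduce
    rw [smul_eq_mul]
    have hle : Finsupp.single v 1 ≤ m := by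
      simpa [Nat.one_le_iff_ne_zero] using Finsupp.mem_support_iff.mp hv
    have hwt : wt m = wt (m - Finsupp.single v 1) + (v.1 + 1) := by
      nth_rewrite 1 [← tsub_add_cancel_of_le hle]
      rw [map_add, wt_single, one_mul]
    split_ifs with h
    · refine weightLE_mono ?_ (mul_mem_weightLE (monomial_mem_weightLE _ _) (xvar_mem_weightLE _ _))
      omega
    · rw [mul_zero]; exact Submodule.zero_mem _
  exact this hg

theorem shift_mem_reducedLE [CharP K p] {d i : ℕ} (hd : 1 ≤ d) (hi : i + e * d < e * (N + 1)) {c : ℤ}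
    {g : MvPolynomial (ℕ × ℕ) K} (hg : g ∈ reducedLE K p e N c) :
    shift K e d i g ∈ reducedLE K p e N (c - d) := by
  have : reducedLE K p e N c ≤
      (reducedLE K p e N (c - d)).comap (shift K e d i : _ →ₗ[K] _) :=
    reducedLE_le (fun g hg => weightLE_le_reducedLE _ (shift_mem_weightLE hg))
      fun g hg => nonreduced_le _ (shift_mem_nonreduced hd hi hg)
  exact this hg

theorem shift_mem_reducedLE_of_forall [CharP K p] (he : 1 ≤ e) {c : ℤ} {g : MvPolynomial (ℕ × ℕ) K}
    (h : ∀ i < e * N, shift K e 1 i g ∈ reducedLE K p e N (c - 1)) (d i : ℕ)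
    (hi : i + e * d < e * N) : shift K e (d + 1) i g ∈ reducedLE K p e N (c - (d + 1)) := by
  induction d generalizing i with
  | zero => simpa using h i (by simpa using hi)
  | succ d ih =>
    rw [shift_succ he (by omega)]
    have h1 := mul_add e d 1
    have h2 := mul_add e N 1
    have h3 : 1 ≤ e * (d + 1) := Nat.mul_pos he (by omega)
    refine Submodule.sub_mem _ ?_ ?_
    · convert shift_mem_reducedLE (d := d + 1) (i := i + e) (by omega) (by omega) (h i (by omega)) using 2
      push_cast; ring
    · convert shift_mem_reducedLE (d := 1) (i := i) le_rfl (by omega) (ih (i + e) (by omega)) using 2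
      push_cast; ring

theorem derivation_mem_of_X {σ : Type*} (D : Derivation K (MvPolynomial σ K) (MvPolynomial σ K))
    {I : Ideal (MvPolynomial σ K)} (h : ∀ v, D (MvPolynomial.X v) ∈ I) (f : MvPolynomial σ K) :
    D f ∈ I := by
  induction f using MvPolynomial.induction_on with
  | C c => rw [MvPolynomial.derivation_C]; exact I.zero_mem
  | add f g hf hg => rw [map_add]; exact I.add_mem hf hg
  | mul_X f v hf =>
    rw [Derivation.leibniz, smul_eq_mul, smul_eq_mul]
    exact I.add_mem (I.mul_mem_left _ (h v)) (I.mul_mem_left _ hf)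

/-- A shift by t + 1 sends x (t, i) to 1, kills x (u, i) for u < t, and sends x (u, i) to a lower
variable for u > t; for u ≥ N that variable is nonreduced. So the shifts are unitriangular in the
partial derivatives. -/
theorem shift_sub_pderiv_sub_sum_mem (t i : ℕ) (g : MvPolynomial (ℕ × ℕ) K) :
    shift K e (t + 1) i g - MvPolynomial.pderiv (t, i) g -
      ∑ u ∈ Finset.Ico (t + 1) N, xvar K (u - t) (i + e * (t + 1)) * MvPolynomial.pderiv (u, i) g ∈
      nonreduced K p e N := by
  let D : Derivation K (MvPolynomial (ℕ × ℕ) K) (MvPolynomial (ℕ × ℕ) K) :=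
    shift K e (t + 1) i - MvPolynomial.pderiv (t, i) -
      ∑ u ∈ Finset.Ico (t + 1) N, xvar K (u - t) (i + e * (t + 1)) • MvPolynomial.pderiv (u, i)
  have hD : ∀ f, D f = shift K e (t + 1) i f - MvPolynomial.pderiv (t, i) f -
      ∑ u ∈ Finset.Ico (t + 1) N, xvar K (u - t) (i + e * (t + 1)) * MvPolynomial.pderiv (u, i) f := by
    intro f
    simp only [D, Derivation.sub_apply]
    congr 1
    rw [← Derivation.coeFnAddMonoidHom_apply, map_sum, Finset.sum_apply]
    rfl
  rw [← hD]
  refine derivation_mem_of_X D (fun v => ?_) g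
  obtain ⟨a, b⟩ := v
  rw [hD, shift_X]
  simp only [MvPolynomial.pderiv_X]
  by_cases hb : b = i
  swap
  · have hne : ∀ u, (a, b) ≠ (u, i) := fun u h => hb (Prod.ext_iff.mp h).2
    simp [hb, hne]
  subst hb
  rcases lt_trichotomy a t with ha | rfl | ha
  · rw [if_neg (by omega), Finset.sum_eq_zero]
    · simp [ha.ne]
    · intro u hu
      have := Finset.mem_Ico.mp hu
      simp [show a ≠ u by omega]
  · rw [Finset.sum_eq_zero]
    · simp [xvar]
    · intro u hu
      have := Finset.mem_Ico.mp hu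
      simp [show a ≠ u by omega]
  · rw [if_pos ⟨rfl, by omega⟩]
    by_cases haN : a < N
    · rw [Finset.sum_eq_single_of_mem a (Finset.mem_Ico.mpr ⟨ha, haN⟩)]
      · simp [ha.ne', show a + 1 - (t + 1) = a - t by omega]
      · intro u _ hu
        simp [hu.symm]
    · rw [Finset.sum_eq_zero]
      · simp only [Pi.single_apply, Prod.mk.injEq, ha.ne', false_and, if_false, sub_zero]
        refine xvar_mem_nonreduced (by omega) ?_
        have := Nat.mul_le_mul_left e (show N - (a + 1 - (t + 1) - 1) ≤ t + 1 by omega)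
        omega
      · intro u hu
        have := Finset.mem_Ico.mp hu
        simp [show a ≠ u by omega]

/-- The triangular system is solved downwards from the largest t, by induction on N - t. -/
theorem pderiv_mem_reducedLE {c : ℤ} {g : MvPolynomial (ℕ × ℕ) K}
    (h : ∀ d i, i + e * d < e * N → shift K e (d + 1) i g ∈ reducedLE K p e N (c - (d + 1)))
    (t i : ℕ) (hi : i < e * (N - t)) :
    MvPolynomial.pderiv (t, i) g ∈ reducedLE K p e N (c - (t + 1)) := by
  induction hn : N - t using Nat.strong_induction_on generalizing t i with
  | _ n ih =>
    have htN : t < N := by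
      by_contra hlt
      rw [Nat.sub_eq_zero_of_le (not_lt.mp hlt)] at hi
      omega
    have h1 := nonreduced_le (c - (t + 1)) (shift_sub_pderiv_sub_sum_mem (p := p) (e := e) (N := N) t i g)
    have h2 : ∑ u ∈ Finset.Ico (t + 1) N, xvar K (u - t) (i + e * (t + 1)) *
        MvPolynomial.pderiv (u, i) g ∈ reducedLE K p e N (c - (t + 1)) := by
      refine Submodule.sum_mem _ fun u hu => ?_
      obtain ⟨hu1, hu2⟩ := Finset.mem_Ico.mp hu
      by_cases hiu : i < e * (N - u)
      · convert mul_mem_reducedLE (xvar_mem_weightLE (u - t) _) (ih (N - u) (by omega) u i hiu rfl) using 2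
        omega
      · refine nonreduced_le _ (Ideal.mul_mem_right _ _ (xvar_mem_nonreduced (by omega) ?_))
        have := Nat.mul_le_mul_left e (show N - (u - t - 1) ≤ N - u + (t + 1) by omega)
        rw [mul_add e (N - u)] at this
        omega
    have h3 := h t i (by
      have := Nat.mul_le_mul_left e (show N - t + t ≤ N by omega)
      rw [mul_add] at this
      omega)
    have h4 := Submodule.sub_mem _ (Submodule.sub_mem _ h3 h2) h1
    convert h4 using 1
    ring

/-- Differentiating a reduced monomial by a variable it contains multiplies it by an exponent
strictly between 0 and p, hence nonzero in `K`. Only the constant monomial escapes, and it is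
covered by c ≥ 0. -/
theorem mem_reducedLE_of_pderiv [CharP K p] {c : ℤ} (hc : 0 ≤ c) {g : MvPolynomial (ℕ × ℕ) K}
    (h : ∀ t i, i < e * (N - t) → MvPolynomial.pderiv (t, i) g ∈ reducedLE K p e N (c - (t + 1))) :
    g ∈ reducedLE K p e N c := by
  rw [mem_reducedLE]
  intro m hm hr
  rcases eq_or_ne m 0 with rfl | hne
  · simpa using hc
  obtain ⟨v, hv⟩ := Finsupp.support_nonempty_iff.mpr hne
  have hle : Finsupp.single v 1 ≤ m := by
    simpa [Nat.one_le_iff_ne_zero] using Finsupp.mem_support_iff.mp hv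
  have hm' : m - Finsupp.single v 1 + Finsupp.single v 1 = m := tsub_add_cancel_of_le hle
  have hwt : wt m = wt (m - Finsupp.single v 1) + (v.1 + 1) := by
    nth_rewrite 1 [← hm']
    rw [map_add, wt_single, one_mul]
  have h1 := mem_reducedLE.mp (h v.1 v.2 (hr.2 v hv)) (m - Finsupp.single v 1) ?_ ?_
  · omega
  · rw [MvPolynomial.mem_support_iff, MvPolynomial.coeff_pderiv, hm']
    refine mul_ne_zero (MvPolynomial.mem_support_iff.mp hm) ?_
    have h0 : m v ≠ 0 := Finsupp.mem_support_iff.mp hv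
    have h2 : (m - Finsupp.single v 1 : ℕ × ℕ →₀ ℕ) v + 1 = m v := by
      rw [Finsupp.tsub_apply, Finsupp.single_eq_same]; omega
    rw [← Nat.cast_add_one, h2]
    intro h3
    exact Nat.not_dvd_of_pos_of_lt (Nat.pos_of_ne_zero h0) (hr.1 v) ((CharP.cast_eq_zero_iff K p _).mp h3)
  · refine ⟨fun u => ((tsub_le_self : m - Finsupp.single v 1 ≤ m) u).trans_lt (hr.1 u), fun u hu => hr.2 u ?_⟩
    rw [Finsupp.mem_support_iff] at hu ⊢
    have := (tsub_le_self : m - Finsupp.single v 1 ≤ m) u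
    omega

/-- A polynomial of positive weight that is not leading-order nonreduced is detected by some
`shift K e 1 i`. -/
theorem mem_reducedLE_of_shift [CharP K p] (he : 1 ≤ e) {c : ℤ} (hc : 0 ≤ c)
    {g : MvPolynomial (ℕ × ℕ) K}
    (h : ∀ i < e * N, shift K e 1 i g ∈ reducedLE K p e N (c - 1)) : g ∈ reducedLE K p e N c :=
  mem_reducedLE_of_pderiv hc (pderiv_mem_reducedLE (shift_mem_reducedLE_of_forall he h))

end Derivations

/-! ### Detection of weight by the operations `P^(p^i)`. -/

section Detection

variable (K : Type*) [Field K] (p e N : ℕ)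

theorem powEval_monomial (m : ℕ × ℕ →₀ ℕ) (a : K) :
    powEval K p (MvPolynomial.monomial m a) = MvPolynomial.monomial (expo p m) a := by
  induction m using Finsupp.induction_linear generalizing a with
  | zero => simp [← MvPolynomial.algebraMap_eq, ← MvPolynomial.C_apply]
  | add m n hm hn =>
    rw [map_add, ← mul_one a, ← MvPolynomial.monomial_mul, map_mul, hm, hn, MvPolynomial.monomial_mul]
  | single v k =>
    rw [expo_single, powEval, MvPolynomial.aeval_monomial, Finsupp.prod_single_index (by simp), ← pow_mul,
      mul_comm k, MvPolynomial.algebraMap_eq, MvPolynomial.C_mul_X_pow_eq_monomial]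

/-- The weight filtration of the dual algebra modulo the truncation ideal. -/
def truncFiltration (c : ℤ) : Submodule K (MvPolynomial ℕ K) :=
  dualFiltration K p c ⊔ (truncIdeal K p e N).restrictScalars K

variable {K p e N}

theorem powEval_eq_sum (g : MvPolynomial (ℕ × ℕ) K) : powEval K p g =
    ∑ m ∈ g.support, MvPolynomial.monomial (expo p m) (g.coeff m) := by
  conv_lhs => rw [← MvPolynomial.support_sum_monomial_coeff g]
  rw [map_sum]
  exact Finset.sum_congr rfl fun m _ => powEval_monomial K p m _

theorem mem_truncFiltration_of_mem_truncIdeal (c : ℤ) {f : MvPolynomial ℕ K}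
    (hf : f ∈ truncIdeal K p e N) : f ∈ truncFiltration K p e N c :=
  Submodule.mem_sup_right hf

theorem exists_expo_or_of_mem_truncFiltration {c : ℤ} {f : MvPolynomial ℕ K}
    (hf : f ∈ truncFiltration K p e N c) {r : ℕ →₀ ℕ} (hr : f.coeff r ≠ 0) :
    (∃ m, expo p m = r ∧ (wt m : ℤ) ≤ c) ∨ ∃ t, p ^ (e * (N - t)) ≤ r t := by
  have h : truncFiltration K p e N c ≤ MvPolynomial.restrictSupport K
      {r | (∃ m, expo p m = r ∧ (wt m : ℤ) ≤ c) ∨ ∃ t, p ^ (e * (N - t)) ≤ r t} := by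
    refine sup_le ?_ fun f hf r hr => Or.inr (mem_truncIdeal.mp hf r hr)
    rw [dualFiltration, Submodule.map_le_iff_le_comap]
    intro g hg
    rw [Submodule.mem_comap, AlgHom.toLinearMap_apply, powEval_eq_sum]
    refine Submodule.sum_mem _ fun m hm => ?_
    rw [MvPolynomial.monomial_mem_restrictSupport]
    exact Or.inl (Or.inl ⟨m, rfl, mem_weightLE.mp hg m hm⟩)
  exact h hf (MvPolynomial.mem_support_iff.mpr hr)

/-- A reduced exponent occurs in an element of the truncated filtration only if its weight allows
it. -/
theorem wt_le_of_mem_truncFiltration (hp : 1 < p) {c : ℤ} {f : MvPolynomial ℕ K}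
    (hf : f ∈ truncFiltration K p e N c) {m : ℕ × ℕ →₀ ℕ} (hm : Reduced p e N m)
    (hr : f.coeff (expo p m) ≠ 0) : (wt m : ℤ) ≤ c := by
  rcases exists_expo_or_of_mem_truncFiltration hf hr with ⟨n, hn, hc⟩ | ⟨t, ht⟩
  · have := (wt_minimal hp hm.1 hn).1
    omega
  · exact absurd (hm.expo_lt t) (not_lt.mpr ht)

/-- A nonreduced monomial of weight c + 1 either admits a carry, losing weight, or evaluates into
the truncation ideal. -/
theorem powEval_mem_truncFiltration (hp : 1 < p) {c : ℤ} {g : MvPolynomial (ℕ × ℕ) K}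
    (h1 : g ∈ weightLE K (c + 1)) (h2 : g ∈ reducedLE K p e N c) :
    powEval K p g ∈ truncFiltration K p e N c := by
  rw [powEval_eq_sum]
  refine Submodule.sum_mem _ fun m hm => ?_
  have hw := mem_weightLE.mp h1 m hm
  by_cases hr : Reduced p e N m
  · rw [← powEval_monomial]
    exact Submodule.mem_sup_left (powEval_mem p (weightLE_mono (mem_reducedLE.mp h2 m hm hr) (monomial_mem_weightLE _ _)))
  · rcases not_reduced_iff.mp hr with ⟨v, hv⟩ | ⟨v, hv, hv'⟩
    · obtain ⟨m', h3, h4⟩ := exists_carry hp hv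
      rw [← h3, ← powEval_monomial]
      exact Submodule.mem_sup_left (powEval_mem p (weightLE_mono (by omega) (monomial_mem_weightLE _ _)))
    · refine Submodule.mem_sup_right (mem_truncIdeal.mpr fun r hr => ?_)
      rw [Finset.mem_singleton.mp (MvPolynomial.support_monomial_subset hr)]
      exact ⟨v.1, (Nat.pow_le_pow_right (by omega) hv').trans (pow_le_expo hv)⟩

/-- A reduced monomial of weight c + 1 cannot be cancelled under evaluation: any other monomial with
the same image has larger weight, which is excluded. -/
theorem mem_reducedLE_of_powEval (hp : 1 < p) {c : ℤ} {g : MvPolynomial (ℕ × ℕ) K}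
    (h1 : g ∈ weightLE K (c + 1)) (h2 : powEval K p g ∈ truncFiltration K p e N c) :
    g ∈ reducedLE K p e N c := by
  classical
  refine mem_reducedLE.mpr fun m hm hr => ?_
  by_contra hlt
  refine hlt (wt_le_of_mem_truncFiltration hp h2 hr ?_)
  rw [powEval_eq_sum, MvPolynomial.coeff_sum, Finset.sum_eq_single_of_mem m hm]
  · rw [MvPolynomial.coeff_monomial, if_pos rfl]
    exact MvPolynomial.mem_support_iff.mp hm
  · intro n hn hne
    rw [MvPolynomial.coeff_monomial, if_neg]
    intro h
    obtain ⟨h3, h4⟩ := wt_minimal hp hr.1 h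
    have := mem_weightLE.mp h1 n hn
    exact hne (h4 (by omega))

variable [Fact p.Prime] [CharP K p]

theorem op_mem_truncFiltration {c : ℤ} {f : MvPolynomial ℕ K} (hf : f ∈ truncFiltration K p e N c)
    {r : ℕ} (h0 : r ≠ 0) (hr : r < p ^ (e * N)) :
    op K (p ^ e) r f ∈ truncFiltration K p e N (c - 1) := by
  obtain ⟨a, ha, b, hb, rfl⟩ := Submodule.mem_sup.mp hf
  rw [map_add]
  exact Submodule.add_mem_sup (op_mem_dualFiltration p e ha h0) (op_mem_truncIdeal hb hr)

theorem mem_truncFiltration_of_op (he : 1 ≤ e) {c : ℤ} (hc : 0 ≤ c) {f : MvPolynomial ℕ K}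
    (hf : f ∈ truncFiltration K p e N (c + 1))
    (h : ∀ i < e * N, op K (p ^ e) (p ^ i) f ∈ truncFiltration K p e N (c - 1)) :
    f ∈ truncFiltration K p e N c := by
  have hp : 1 < p := (Fact.out : p.Prime).one_lt
  obtain ⟨_, ⟨g, hg, rfl⟩, b, hb, rfl⟩ := Submodule.mem_sup.mp hf
  refine Submodule.add_mem _ ?_ (Submodule.mem_sup_right hb)
  refine powEval_mem_truncFiltration hp hg (mem_reducedLE_of_shift he hc fun i hi => ?_)
  have hpi : p ^ i ≠ 0 := pow_ne_zero _ (by omega)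
  have h1 := h i hi
  rw [map_add] at h1
  have h2 := (Submodule.add_mem_iff_left _ (mem_truncFiltration_of_mem_truncIdeal _
    (op_mem_truncIdeal hb (Nat.pow_lt_pow_right hp hi)))).mp h1
  rw [AlgHom.toLinearMap_apply, op_powEval] at h2
  have h3 := coeff_liftOp_sub_mem p e hg hpi
  have h4 := coeff_liftOp_mem p e hg hpi
  rw [coeff_symbolOp hp] at h3
  -- The operation and its symbol differ by weight c - 1, so the bound on the operation passes to
  -- the symbol.
  rw [← sub_sub_cancel ((liftOp K p e g).coeff (p ^ i)) (shift K e 1 i g)]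
  refine Submodule.sub_mem _ (mem_reducedLE_of_powEval hp ?_ h2)
    (weightLE_le_reducedLE _ (weightLE_mono (by omega) h3))
  exact weightLE_mono (by omega) h4

end Detection

/-! ### Polynomials annihilated by powers of the augmentation ideal. -/

section Pairing

variable {K : Type*} [Field K] {p e n : ℕ}

variable (K p e n)

/-- The augmentation of `A_q(n-2)`. -/
abbrev subAug : sub K p e n →ₐ[K] K := (aug K (p ^ e)).comp (sub K p e n).val

variable {K p e n}

theorem pow_ker_succ_le {A : Type*} [Ring A] (I : Ideal A) (k : ℕ) : I ^ (k + 1) ≤ I ^ k := by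
  cases k with
  | zero => rw [Submodule.pow_zero, Ideal.one_eq_top]; exact le_top
  | succ k =>
    rw [Submodule.pow_succ' _ k.succ_ne_zero, Submodule.mul_le]
    exact fun x _ y hy => Ideal.mul_mem_left _ x hy

theorem coe_mem_pow_ker {k : ℕ} {b : sub K p e n}
    (hb : b ∈ (RingHom.ker (subAug K p e n) : Ideal _) ^ k) :
    (b : SteenrodAlg K (p ^ e)) ∈ (RingHom.ker (aug K (p ^ e)) : Ideal _) ^ k := by
  induction k generalizing b with
  | zero => rw [Submodule.pow_zero, Ideal.one_eq_top]; trivial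
  | succ k ih =>
    rw [Submodule.pow_succ] at hb ⊢
    induction hb using Submodule.mul_induction_on' with
    | mem_mul_mem x hx y hy => exact Submodule.mul_mem_mul (ih hx) hy
    | add x _ y _ hx hy => exact Submodule.add_mem _ hx hy

variable [Fact p.Prime]

theorem mul_P_mem_pow_succ {w i : ℕ} (hi : i < (n - 1) * e) {b : sub K p e n}
    (hb : b ∈ (RingHom.ker (subAug K p e n) : Ideal _) ^ w) :
    b * ⟨P K (p ^ e) (p ^ i), Algebra.subset_adjoin ⟨i, hi, rfl⟩⟩ ∈
      (RingHom.ker (subAug K p e n) : Ideal _) ^ (w + 1) := by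
  rw [Submodule.pow_succ]
  refine Submodule.mul_mem_mul hb ?_
  change aug K (p ^ e) (P K (p ^ e) (p ^ i)) = 0
  rw [aug_P, if_neg (pow_ne_zero _ (Fact.out : p.Prime).ne_zero)]

variable [CharP K p] (he : 1 ≤ e)

theorem rep_mem_truncIdeal {b : SteenrodAlg K (p ^ e)} (hb : b ∈ sub K p e n) {f : MvPolynomial ℕ K}
    (hf : f ∈ truncIdeal K p e (n - 1)) : rep p e he b f ∈ truncIdeal K p e (n - 1) := by
  have hp : 1 < p := (Fact.out : p.Prime).one_lt
  induction hb using Algebra.adjoin_induction generalizing f with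
  | mem x hx =>
    obtain ⟨i, hi, rfl⟩ := hx
    rw [rep_P]
    exact op_mem_truncIdeal hf (Nat.pow_lt_pow_right hp (by rwa [mul_comm]))
  | algebraMap r =>
    rw [AlgHom.commutes, Module.algebraMap_end_apply, MvPolynomial.smul_eq_C_mul]
    exact Ideal.mul_mem_left _ _ hf
  | add x y _ _ hx hy => rw [map_add, LinearMap.add_apply]; exact Ideal.add_mem _ (hx hf) (hy hf)
  | mul x y _ _ hx hy => rw [map_mul, Module.End.mul_apply]; exact hx (hy hf)

/-- If I^(w+1) annihilates f, then I^w annihilates each `P^(p^i)` f, since I^w P^(p^i) lies in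
I^(w+1). Induction lowers the weight of these images, and `mem_truncFiltration_of_op` then lowers
that of f. In weight 0, f is a constant modulo the ideal, which pairing with 1 shows to be zero. -/
theorem mem_truncFiltration_pred (w : ℕ) {f : MvPolynomial ℕ K}
    (hf : f ∈ truncFiltration K p e (n - 1) w)
    (h : ∀ b ∈ (RingHom.ker (subAug K p e n) : Ideal _) ^ w, counit K (rep p e he b f) = 0) :
    f ∈ truncFiltration K p e (n - 1) (w - 1) := by
  have hp : 1 < p := (Fact.out : p.Prime).one_lt
  induction w generalizing f with
  | zero =>
    obtain ⟨_, ⟨g, hg, rfl⟩, b, hb, rfl⟩ := Submodule.mem_sup.mp hf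
    have hg' : g = MvPolynomial.C (g.coeff 0) := by
      rw [← MvPolynomial.totalDegree_eq_zero_iff_eq_C, MvPolynomial.totalDegree_eq_zero_iff]
      intro m hm v
      have h0 := mem_weightLE.mp hg m hm
      by_contra hv
      have hle : Finsupp.single v 1 ≤ m := by
        simpa [Nat.one_le_iff_ne_zero] using hv
      rw [← tsub_add_cancel_of_le hle, map_add, wt_single] at h0
      push_cast at h0
      omega
    have h1 := h 1 (by rw [Submodule.pow_zero, Ideal.one_eq_top]; trivial)
    rw [OneMemClass.coe_one, map_one, Module.End.one_apply, map_add,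
      counit_of_mem_truncIdeal (by omega) hb, add_zero, hg', AlgHom.toLinearMap_apply,
      ← MvPolynomial.algebraMap_eq, AlgHom.commutes, AlgHom.commutes] at h1
    have h2 : g = 0 := by
      rw [hg', show g.coeff 0 = 0 from h1, map_zero]
    rw [h2, map_zero, zero_add]
    exact Submodule.mem_sup_right hb
  | succ w ih =>
    have hw : (((w + 1 : ℕ) : ℤ) - 1) = (w : ℤ) := by push_cast; ring
    rw [hw]
    refine mem_truncFiltration_of_op he (Int.natCast_nonneg w) (by exact_mod_cast hf) fun i hi => ?_
    refine ih ?_ fun b hb => ?_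
    · rw [← hw]
      exact op_mem_truncFiltration hf (pow_ne_zero _ (by omega)) (Nat.pow_lt_pow_right hp hi)
    · have := h _ (mul_P_mem_pow_succ (by rwa [mul_comm] at hi) hb)
      rwa [Subalgebra.coe_mul, map_mul, Module.End.mul_apply, rep_P] at this

theorem mem_truncFiltration_of_annihilated (k : ℕ) {f : MvPolynomial ℕ K}
    (h : ∀ b ∈ (RingHom.ker (subAug K p e n) : Ideal _) ^ k, counit K (rep p e he b f) = 0) :
    f ∈ truncFiltration K p e (n - 1) (k - 1) := by
  have hmono : Antitone fun k => (RingHom.ker (subAug K p e n) : Ideal _) ^ k :=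
    antitone_nat_of_succ_le (pow_ker_succ_le _)
  obtain ⟨w, hw⟩ := exists_mem_dualFiltration p f
  have h1 : ∀ d : ℕ, f ∈ truncFiltration K p e (n - 1) ((k + d : ℕ) - 1) →
      f ∈ truncFiltration K p e (n - 1) (k - 1) := by
    intro d
    induction d with
    | zero => simp
    | succ d ih =>
      intro hf
      refine ih (mem_truncFiltration_pred he (k + d) ?_ fun b hb => h b (hmono (Nat.le_add_right k d) hb))
      rwa [show ((k + d : ℕ) : ℤ) = ((k + (d + 1) : ℕ) : ℤ) - 1 by push_cast; ring]
  refine h1 (w + 1) (Submodule.mem_sup_left (dualFiltration_mono p ?_ hw))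
  push_cast
  omega

end Pairing

/-! ### Counting reduced exponents by weight. -/

section ReducedExponents

/-- The variables `x (t, s)` with `s < e * (N - t)`. -/
def truncVars (e N : ℕ) : Finset (ℕ × ℕ) :=
  (Finset.range N ×ˢ Finset.range (e * N)).filter fun v => v.2 < e * (N - v.1)

theorem mem_truncVars {e N : ℕ} {v : ℕ × ℕ} :
    v ∈ truncVars e N ↔ v.1 ∈ Finset.range N ∧ v.2 ∈ Finset.range (e * (N - v.1)) := by
  simp only [truncVars, Finset.mem_filter, Finset.mem_product, Finset.mem_range]
  have := Nat.mul_le_mul_left e (Nat.sub_le N v.1)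
  constructor
  · rintro ⟨⟨h1, _⟩, h2⟩; exact ⟨h1, h2⟩
  · rintro ⟨h1, h2⟩; exact ⟨⟨h1, by omega⟩, h2⟩

/-- The finite set of reduced exponents. -/
def reducedExps (p e N : ℕ) : Finset (ℕ × ℕ →₀ ℕ) :=
  (truncVars e N).finsupp fun _ => Finset.range p

theorem mem_reducedExps {p e N : ℕ} (hp : 0 < p) {m : ℕ × ℕ →₀ ℕ} :
    m ∈ reducedExps p e N ↔ Reduced p e N m := by
  rw [reducedExps, Finset.mem_finsupp_iff, Reduced]
  have key : ∀ v : ℕ × ℕ, v ∈ truncVars e N ↔ v.2 < e * (N - v.1) := fun v => by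
    rw [mem_truncVars, Finset.mem_range, Finset.mem_range]
    refine ⟨fun h => h.2, fun h => ⟨?_, h⟩⟩
    by_contra hN
    rw [Nat.sub_eq_zero_of_le (not_lt.mp hN)] at h
    omega
  constructor
  · rintro ⟨h1, h2⟩
    refine ⟨fun v => ?_, fun v hv => (key v).mp (h1 hv)⟩
    by_cases hv : m v = 0
    · rwa [hv]
    · exact Finset.mem_range.mp (h2 v (h1 (Finsupp.mem_support_iff.mpr hv)))
  · rintro ⟨h1, h2⟩
    exact ⟨fun v hv => (key v).mpr (h2 v hv), fun v _ => Finset.mem_range.mpr (h1 v)⟩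

theorem sum_X_pow_wt (p e N : ℕ) :
    ∑ m ∈ reducedExps p e N, (PowerSeries.X : PowerSeries ℚ) ^ wt m =
      ∏ t ∈ Finset.range N,
        (∑ d ∈ Finset.range p, (PowerSeries.X : PowerSeries ℚ) ^ (d * (t + 1))) ^ (e * (N - t)) := by
  classical
  have h1 : ∏ v ∈ truncVars e N, ∑ d ∈ Finset.range p, (PowerSeries.X : PowerSeries ℚ) ^ (d * (v.1 + 1)) =
      ∏ t ∈ Finset.range N,
        (∑ d ∈ Finset.range p, (PowerSeries.X : PowerSeries ℚ) ^ (d * (t + 1))) ^ (e * (N - t)) := by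
    rw [Finset.prod_finset_product (truncVars e N) (Finset.range N) (fun t => Finset.range (e * (N - t)))
      fun v => mem_truncVars]
    simp
  -- Expanding the product chooses one digit below p for each variable, that is, a reduced exponent.
  rw [← h1, Finset.prod_sum, reducedExps, Finset.finsupp, Finset.sum_map]
  refine Finset.sum_congr (by congr!) fun f _ => ?_
  rw [Finset.prod_pow_eq_pow_sum]
  congr 1
  rw [Function.Embedding.coeFn_mk, wt, Finsupp.weight_apply,
    Finsupp.sum_of_support_subset _ (Finsupp.support_indicator_subset _ _) _ (by simp),
    ← Finset.sum_attach]
  refine Finset.sum_congr rfl fun v _ => ?_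
  rw [Finsupp.indicator_of_mem v.2, smul_eq_mul]

theorem geom_quotient (p k : ℕ) (hk : k ≠ 0) :
    ∑ d ∈ Finset.range p, (PowerSeries.X : PowerSeries ℚ) ^ (d * k) =
      (1 - PowerSeries.X ^ (k * p)) * (1 - PowerSeries.X ^ k)⁻¹ := by
  have h0 : PowerSeries.constantCoeff (1 - (PowerSeries.X : PowerSeries ℚ) ^ k) ≠ 0 := by
    simp [hk]
  have h1 := geom_sum_mul_neg ((PowerSeries.X : PowerSeries ℚ) ^ k) p
  rw [pow_mul, ← h1, mul_assoc, PowerSeries.mul_inv_cancel _ h0, mul_one]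
  exact Finset.sum_congr rfl fun d _ => by rw [← pow_mul, mul_comm]

end ReducedExponents

/-! ### Perfect pairing with the reduced monomials. -/

section PerfectPairing

theorem mayFiltration_le_inducedFiltration {K : Type*} [Field K] {p e n : ℕ} (k : ℕ) :
    mayFiltration K p e n k ≤ inducedFiltration K p e n k := fun _ hb => coe_mem_pow_ker hb

variable (K : Type*) [Field K] (p e n : ℕ) [Fact p.Prime] [CharP K p] (he : 1 ≤ e)

/-- The pairing of `A_q(n-2)` with the reduced monomials. -/
def pairing : sub K p e n →ₗ[K] (reducedExps p e (n - 1) → K) :=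
  LinearMap.pi fun m => (counit K).toLinearMap ∘ₗ
    LinearMap.applyₗ (MvPolynomial.monomial (expo p m.1) (1 : K)) ∘ₗ (rep p e he).toLinearMap ∘ₗ
      (sub K p e n).val.toLinearMap

variable {K p e n}

theorem pairing_apply (b : sub K p e n) (m : reducedExps p e (n - 1)) :
    pairing K p e n he b m = counit K (rep p e he b (MvPolynomial.monomial (expo p m.1) 1)) := rfl

/-- Any monomial is either reduced or in the truncation ideal, which the subalgebra preserves and
the counit kills. Faithfulness of the full pairing then suffices. -/
theorem pairing_injective : Function.Injective (pairing K p e n he) := by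
  have hp : 1 < p := (Fact.out : p.Prime).one_lt
  rw [injective_iff_map_eq_zero]
  intro b hb
  refine Subtype.ext (eq_zero_of_counit_rep p e he fun g => ?_)
  induction g using MvPolynomial.induction_on' with
  | add f g hf hg => rw [map_add, map_add, hf, hg, add_zero]
  | monomial r a =>
    rw [← mul_one a, ← smul_eq_mul, ← MvPolynomial.smul_monomial, map_smul, map_smul]
    obtain ⟨m, hm, rfl⟩ := exists_reduced hp r
    by_cases hr : Reduced p e (n - 1) m
    · have := congrFun hb ⟨m, (mem_reducedExps (by omega)).mpr hr⟩
      rw [pairing_apply] at this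
      rw [this]
      simp
    · rcases not_reduced_iff.mp hr with ⟨v, hv⟩ | ⟨v, hv, hv'⟩
      · exact absurd (hm v) (not_lt.mpr hv)
      · rw [counit_of_mem_truncIdeal (by omega) (rep_mem_truncIdeal he b.2 (mem_truncIdeal.mpr fun r hr => ?_)),
          smul_zero]
        rw [Finset.mem_singleton.mp (MvPolynomial.support_monomial_subset hr)]
        exact ⟨v.1, (Nat.pow_le_pow_right (by omega) hv').trans (pow_le_expo hv)⟩

theorem pairing_eq_zero_of_mem {k : ℕ} {b : sub K p e n} (hb : b ∈ inducedFiltration K p e n k)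
    {m : reducedExps p e (n - 1)} (hm : wt m.1 < k) : pairing K p e n he b m = 0 := by
  have hb' : (b : SteenrodAlg K (p ^ e)) ∈ (RingHom.ker (aug K (p ^ e)) : Ideal _) ^ k := hb
  rw [pairing_apply, ← powEval_monomial, dualFiltration_of_neg p _ (rep_mem_dualFiltration p e he k hb'
    (powEval_mem p (monomial_mem_weightLE m.1 (1 : K)))), map_zero]
  omega

/-- If `v` were not attained, a functional `φ` would vanish on the image of I^k but not on `v`. Read
as a polynomial `f`, `φ` is annihilated by I^k, so `f` has weight at most k - 1; but `v` is
supported in weights at least k, which forces φ(v) = 0. -/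
theorem exists_pairing_eq {k : ℕ} {v : reducedExps p e (n - 1) → K}
    (hv : ∀ m : reducedExps p e (n - 1), wt m.1 < k → v m = 0) :
    ∃ b ∈ mayFiltration K p e n k, pairing K p e n he b = v := by
  classical
  have hp : 1 < p := (Fact.out : p.Prime).one_lt
  by_contra hne
  have hv' : v ∉ (mayFiltration K p e n k).map (pairing K p e n he) := hne
  obtain ⟨φ, hφ, hker⟩ := Submodule.exists_le_ker_of_notMem hv'
  have hφs : ∀ w, φ w = ∑ m, w m * φ (Pi.single m 1) := fun w => by
    rw [LinearMap.pi_apply_eq_sum_univ φ w]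
    refine Finset.sum_congr rfl fun m _ => ?_
    rw [smul_eq_mul]
    congr 2
    ext j
    simp [Pi.single_apply, eq_comm]
  set f : MvPolynomial ℕ K := ∑ m : reducedExps p e (n - 1),
    MvPolynomial.monomial (expo p m.1) (φ (Pi.single m 1)) with hf
  have h1 : f ∈ truncFiltration K p e (n - 1) (k - 1) := by
    refine mem_truncFiltration_of_annihilated he k fun b hb => ?_
    have h2 : φ (pairing K p e n he b) = 0 := hker ⟨b, hb, rfl⟩
    rw [hφs] at h2
    rw [hf, map_sum, map_sum, ← h2]
    refine Finset.sum_congr rfl fun m _ => ?_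
    rw [pairing_apply, ← mul_one (φ _), ← smul_eq_mul, ← MvPolynomial.smul_monomial, map_smul, map_smul,
      smul_eq_mul, smul_eq_mul, mul_one, mul_comm]
  refine hφ ?_
  rw [hφs]
  refine Finset.sum_eq_zero fun m _ => ?_
  by_cases hm : wt m.1 < k
  · rw [hv m hm, zero_mul]
  · have hred := (mem_reducedExps (by omega)).mp m.2
    have hc : f.coeff (expo p m.1) = φ (Pi.single m 1) := by
      rw [hf, MvPolynomial.coeff_sum, Finset.sum_eq_single_of_mem m (Finset.mem_univ m)]
      · rw [MvPolynomial.coeff_monomial, if_pos rfl]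
      · intro j _ hj
        rw [MvPolynomial.coeff_monomial, if_neg]
        exact fun h => hj (Subtype.ext (eq_of_expo_eq ((mem_reducedExps (by omega)).mp j.2).1 hred.1 h))
    by_cases h0 : φ (Pi.single m 1) = 0
    · rw [h0, mul_zero]
    · have := wt_le_of_mem_truncFiltration hp h1 hred (hc ▸ h0)
      omega

theorem mem_mayFiltration_iff {k : ℕ} {b : sub K p e n} : b ∈ mayFiltration K p e n k ↔
    ∀ m : reducedExps p e (n - 1), wt m.1 < k → pairing K p e n he b m = 0 := by
  refine ⟨fun hb m hm => pairing_eq_zero_of_mem he (mayFiltration_le_inducedFiltration k hb) hm, fun h => ?_⟩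
  obtain ⟨b', hb', h'⟩ := exists_pairing_eq he h
  rwa [← pairing_injective he h']

end PerfectPairing

/-! ### Equality of the filtrations and the Poincaré series. -/

section Conclusion

variable {K : Type*} [Field K] {p e n : ℕ} [Fact p.Prime] [CharP K p]

theorem mayFiltration_eq_inducedFiltration (he : 1 ≤ e) (k : ℕ) :
    mayFiltration K p e n k = inducedFiltration K p e n k :=
  le_antisymm (mayFiltration_le_inducedFiltration k) fun _ hb =>
    (mem_mayFiltration_iff he).mpr fun _ hm => pairing_eq_zero_of_mem he hb hm

/-- The homogeneous components of the associated graded algebra have the reduced exponents of the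
given weight as a basis. -/
theorem nonempty_E0_equiv (he : 1 ≤ e) (k : ℕ) : Nonempty (E0 K p e n k ≃ₗ[K]
    ({m : reducedExps p e (n - 1) // wt m.1 = k} → K)) := by
  classical
  let ψ : mayFiltration K p e n k →ₗ[K] ({m : reducedExps p e (n - 1) // wt m.1 = k} → K) :=
    LinearMap.funLeft K K Subtype.val ∘ₗ pairing K p e n he ∘ₗ (mayFiltration K p e n k).subtype
  have hψ : Function.Surjective ψ := fun u => by
    obtain ⟨b, hb, h⟩ := exists_pairing_eq (n := n) (k := k) he
      (v := fun m => if h : wt m.1 = k then u ⟨m, h⟩ else 0) fun m hm => dif_neg hm.ne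
    refine ⟨⟨b, hb⟩, funext fun m => ?_⟩
    change pairing K p e n he b m.1 = u m
    rw [h]
    exact dif_pos m.2
  have hker : (mayFiltration K p e n (k + 1)).submoduleOf (mayFiltration K p e n k) =
      LinearMap.ker ψ := by
    ext b
    rw [Submodule.submoduleOf, Submodule.mem_comap, Submodule.subtype_apply, mem_mayFiltration_iff he,
      LinearMap.mem_ker]
    constructor
    · exact fun h => funext fun m => h m.1 (by rw [m.2]; exact Nat.lt_succ_self k)
    · intro h m hm
      rcases Nat.lt_succ_iff_lt_or_eq.mp hm with hm | hm
      · exact (mem_mayFiltration_iff he).mp b.2 m hm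
      · exact congrFun h ⟨m, hm⟩
  exact ⟨(Submodule.quotEquivOfEq _ _ hker).trans (ψ.quotKerEquivOfSurjective hψ)⟩

theorem finiteDimensional_E0 (he : 1 ≤ e) (k : ℕ) : FiniteDimensional K (E0 K p e n k) := by
  obtain ⟨E⟩ := nonempty_E0_equiv (K := K) (p := p) (n := n) he k
  exact Module.Finite.equiv E.symm

theorem poincareSeries_E0 (he : 1 ≤ e) : poincareSeries K (E0 K p e n) =
    ∏ k ∈ Finset.Icc 1 (n - 1),
      ((1 - (PowerSeries.X : PowerSeries ℚ) ^ (k * p)) * (1 - PowerSeries.X ^ k)⁻¹) ^ (e * (n - k)) := by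
  classical
  have h1 : poincareSeries K (E0 K p e n) =
      ∑ m ∈ reducedExps p e (n - 1), (PowerSeries.X : PowerSeries ℚ) ^ wt m := by
    ext k
    obtain ⟨E⟩ := nonempty_E0_equiv (K := K) (p := p) (n := n) he k
    rw [poincareSeries, PowerSeries.coeff_mk, E.finrank_eq, Module.finrank_fintype_fun_eq_card, map_sum]
    simp only [PowerSeries.coeff_X_pow]
    rw [Finset.sum_ite, Finset.sum_const_zero, add_zero, Finset.sum_const, nsmul_eq_mul, mul_one,
      Fintype.card_subtype, ← Finset.card_map (Function.Embedding.subtype _)]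
    congr 2
    ext m
    simp [eq_comm, and_comm]
  rw [h1, sum_X_pow_wt]
  refine Finset.prod_bij' (fun t _ => t + 1) (fun k _ => k - 1) ?_ ?_ ?_ ?_ ?_
  · intro t ht
    have := Finset.mem_range.mp ht
    exact Finset.mem_Icc.mpr (by omega)
  · intro k hk
    have := Finset.mem_Icc.mp hk
    exact Finset.mem_range.mpr (by omega)
  · intro t _; simp
  · intro k hk
    have := Finset.mem_Icc.mp hk
    omega
  · intro t _
    rw [geom_quotient p (t + 1) t.succ_ne_zero, show n - 1 - t = n - (t + 1) by omega]

end Conclusion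

end SteenrodQ

end

theorem proposition4p4 (p : ℕ) [Fact p.Prime] (n : ℕ) (hn : 1 ≤ n) :
    -- the case `q = p`
    ((∀ k, FiniteDimensional (ZMod p) (SteenrodQ.E0 (ZMod p) p 1 n k)) ∧
      SteenrodQ.poincareSeries (ZMod p) (SteenrodQ.E0 (ZMod p) p 1 n) =
        ∏ k ∈ Finset.Icc 1 (n - 1),
          ((1 - (PowerSeries.X : PowerSeries ℚ) ^ (k * p)) * (1 - PowerSeries.X ^ k)⁻¹) ^ (n - k)) ∧
    -- the case `q = p ^ e`, where `K` is the field with `q` elements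
    (∀ (e : ℕ) (_ : 1 ≤ e) (K : Type*) [Field K] (_ : Nat.card K = p ^ e),
      (∀ k, FiniteDimensional K (SteenrodQ.E0 K p e n k)) ∧
      SteenrodQ.poincareSeries K (SteenrodQ.E0 K p e n) =
        SteenrodQ.poincareSeries (ZMod p) (SteenrodQ.E0 (ZMod p) p 1 n) ^ e ∧
      -- the May filtration of `A_q(n-2)` is the one induced by the May filtration of `A_q`
      ∀ k, SteenrodQ.mayFiltration K p e n k = SteenrodQ.inducedFiltration K p e n k) := by
  have hone : SteenrodQ.poincareSeries (ZMod p) (SteenrodQ.E0 (ZMod p) p 1 n) =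
      ∏ k ∈ Finset.Icc 1 (n - 1),
        ((1 - (PowerSeries.X : PowerSeries ℚ) ^ (k * p)) * (1 - PowerSeries.X ^ k)⁻¹) ^ (n - k) := by
    rw [SteenrodQ.poincareSeries_E0 le_rfl]
    simp only [one_mul]
  refine ⟨⟨SteenrodQ.finiteDimensional_E0 le_rfl, hone⟩, fun e he K _ hK => ?_⟩
  have hfin : Finite K := Nat.finite_of_card_ne_zero
    (hK ▸ pow_ne_zero _ (Fact.out : p.Prime).ne_zero)
  have := Fintype.ofFinite K
  -- The rest of the argument uses only the characteristic of `K`, not its cardinality.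
  have : CharP K p := charP_of_card_eq_prime_pow (Nat.card_eq_fintype_card (α := K) ▸ hK)
  refine ⟨SteenrodQ.finiteDimensional_E0 he, ?_, SteenrodQ.mayFiltration_eq_inducedFiltration he⟩
  rw [SteenrodQ.poincareSeries_E0 he, hone, ← Finset.prod_pow]
  exact Finset.prod_congr rfl fun k _ => by rw [mul_comm e, pow_mul]
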